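/- Let $(X,d)$ be a complete separable metric space and let $E:X\to\mathbb R\cup\{+\infty\}$ be lower semicontinuous, with dense domain $D(E)=\{E<\infty\}$, and bounded from below on every $d$-bounded set. Assume that for some $\lambda\in\mathbb R$ every $x\in X$ is the starting point of an $\mathrm{EVI}_\lambda$-gradient flow of $E$, that is, of a locally absolutely continuous curve $(\gamma_t)_{t>0}$ in $X$ with $\gamma_t\to x$ as $t\downarrow0$ such that, for every $z\in X$ and for a.e. $t>0$, $$\tfrac12\tfrac{d}{dt}d^2(\gamma_t,z)+\tfrac\lambda2 d^2(\gamma_t,z)+E(\gamma_t)\le E(z).$$ The slope of $E$ is $|\partial E|(x)=\limsup_{z\to x}\frac{[E(x)-E(z)]^+}{d(x,z)}$ if $x\in D(E)$ ($0$ if $x$ is isolated), and $|\partial E|(x)=+\infty$ if $x\notin D(E)$. Let $\sigma$ be a Hausdorff topology on $X$ such that every $d$-bounded sequence has a $\sigma$-convergent subsequence and such that $d$ (jointly in its two arguments) and $|\partial E|$ are sequentially $\sigma$-lower semicontinuous. For $\gamma\in C([0,1],X)$ set $\mathcal A(\gamma)=\frac12\int_0^1|\dot\gamma_t|^2\,dt$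 if $\gamma$ is absolutely continuous, where $|\dot\gamma_t|$ is the metric speed, and $\mathcal A(\gamma)=+\infty$ otherwise; set $\mathcal I(\gamma)=\frac12\int_0^1|\partial E|^2(\gamma_t)\,dt$. Given $x,y\in X$, write $\gamma:x\leadsto y$ if $\gamma\in C([0,1],X)$, $\gamma_0=x$, $\gamma_1=y$. For $\varepsilon>0$, the $\varepsilon$-Schrödinger problem between $x$ and $y$ is to minimize $\mathcal A(\gamma)+\varepsilon^2\mathcal I(\gamma)$ over $\gamma:x\leadsto y$; it is called solvable if its infimum is finite and attained. Assume that the $\varepsilon$-Schrödinger problem between $x$ and $y$ is solvable for some $\varepsilon>0$, and let $\varepsilon_k>0$ with $\varepsilon_k\to0$. Then $$\lim_{k\to\infty}\ \inf_{\gamma:x\leadsto y}\big\{\mathcal A(\gamma)+\varepsilon_k^2\mathcal I(\gamma)\big\}=\inf_{\gamma:x\leadsto y}\mathcal A(\gamma).$$ Moreover, if for every $k$ the curve $\omega^k:x\leadsto y$ is a minimizer of the $\varepsilon_k$-Schrödinger problem, then $$\lim_{k\to\infty}\big\{\mathcal A(\omega^k)+\varepsilon_k^2\mathcal I(\omega^k)\big\}=\inf_{\gamma:x\leadsto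 y}\mathcal A(\gamma),$$ and there exist a curve $\omega^0:x\leadsto y$ in $C([0,1],X)$ and a subsequence $(k_j)$ such that $\omega^{k_j}_t\to\omega^0_t$ with respect to $\sigma$ for every $t\in[0,1]$ and $$\mathcal A(\omega^0)=\inf_{\gamma:x\leadsto y}\mathcal A(\gamma).$$ -/

import Mathlib

open Set Filter Topology MeasureTheory
open scoped ENNReal

/-- The curves `C([0,1], X)`, continuous for the metric topology of `X`. -/
abbrev Curve (X : Type*) [MetricSpace X] : Type _ := C(unitInterval, X)

noncomputable section

namespace Curve

variable {X : Type*} [MetricSpace X]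

/-- The curve as a function on `ℝ`, extended by constants outside `[0,1]`. -/
def ext (γ : Curve X) : ℝ → X := Set.IccExtend zero_le_one (γ : unitInterval → X)

/-- The position `γ_t`. -/
def pos (γ : Curve X) (t : unitInterval) : X := γ t

/-- `γ` runs from `x` to `y`. -/
def Joins (γ : Curve X) (x y : X) : Prop := γ 0 = x ∧ γ 1 = y

end Curve

/-- The metric speed `|γ'|(t)`. It is written as a `limsup` of difference quotients; for an absolutely
continuous curve the limit exists at almost every time. -/
def metricSpeed {X : Type*} [MetricSpace X] (γ : ℝ → X) (t : ℝ) : ℝ≥0∞ :=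
  limsup (fun s : ℝ => edist (γ s) (γ t) / edist s t) (𝓝[≠] t)

/-- The descending slope `|∂E|(x)` of `E : X → ℝ ∪ {+∞}`: it is `+∞` outside the domain of `E`, and
otherwise the `limsup` of `[E x - E y]⁺ / d(x,y)` as `y → x`, `y ≠ x` (which is `0` at an isolated
point, where the filter `𝓝[≠] x` is trivial). -/
def metricSlope {X : Type*} [MetricSpace X] (E : X → EReal) (x : X) : ℝ≥0∞ :=
  if E x = ⊤ then ⊤
  else limsup (fun y : X => (E x - E y).toENNReal / edist x y) (𝓝[≠] x)

/-- The curve `(γ_t)_{t>0}` is an `EVI_lam`-gradient flow of `E` starting at `x`. Only the values at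
positive times matter. -/
structure IsEVIFlow {X : Type*} [MetricSpace X] (E : X → EReal) (lam : ℝ) (γ : ℝ → X) (x : X) :
    Prop where
  locally_ac : ∀ a b : ℝ, 0 < a → a ≤ b → AbsolutelyContinuousOnInterval γ a b
  evi : ∀ y : X, ∀ᵐ t ∂(volume.restrict (Ioi (0 : ℝ))),
    (((1 / 2) * deriv (fun s : ℝ => dist (γ s) y ^ 2) t + lam / 2 * dist (γ t) y ^ 2 : ℝ) : EReal)
      + E (γ t) ≤ E y
  starts : Tendsto γ (𝓝[>] (0 : ℝ)) (𝓝 x)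

/-- The standing assumptions on `E : X → ℝ ∪ {+∞}`: lower semicontinuity, dense domain, boundedness
from below on bounded sets, and existence of `EVI_lam`-gradient flows from every point, for some
real `lam`. -/
structure IsEVIFunctional {X : Type*} [MetricSpace X] (E : X → EReal) : Prop where
  ne_bot : ∀ x, E x ≠ ⊥
  lsc : LowerSemicontinuous E
  dense_domain : Dense {x | E x ≠ ⊤}
  bounded_below : ∀ B : Set X, Bornology.IsBounded B → ∃ c : ℝ, ∀ x ∈ B, (c : EReal) ≤ E x
  exists_flow : ∃ lam : ℝ, ∀ x : X, ∃ γ : ℝ → X, IsEVIFlow E lam γ x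

/-- The auxiliary topology `σ`: Hausdorff, every metrically bounded sequence has a `σ`-convergent
subsequence, and distance and slope are sequentially `σ`-lower semicontinuous. -/
structure IsAdmissibleTopology {X : Type*} [MetricSpace X] (E : X → EReal)
    (σ : TopologicalSpace X) : Prop where
  hausdorff : @T2Space X σ
  bounded_seq_compact : ∀ u : ℕ → X, Bornology.IsBounded (range u) →
    ∃ (z : X) (φ : ℕ → ℕ), StrictMono φ ∧ Tendsto (fun n => u (φ n)) atTop (@nhds X σ z)
  dist_lsc : ∀ (u v : ℕ → X) (a b : X), Tendsto u atTop (@nhds X σ a) →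
    Tendsto v atTop (@nhds X σ b) → edist a b ≤ liminf (fun n => edist (u n) (v n)) atTop
  slope_lsc : ∀ (u : ℕ → X) (a : X), Tendsto u atTop (@nhds X σ a) →
    metricSlope E a ≤ liminf (fun n => metricSlope E (u n)) atTop

section Problem

variable {X : Type*} [MetricSpace X]

open Classical in
/-- The kinetic action `𝓐(γ) = ½ ∫₀¹ |γ'|²`, equal to `+∞` if `γ` is not absolutely continuous. -/
def kineticAction (γ : Curve X) : ℝ≥0∞ :=
  if AbsolutelyContinuousOnInterval γ.ext 0 1 then
    2⁻¹ * ∫⁻ t in Icc (0 : ℝ) 1, metricSpeed γ.ext t ^ 2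
  else ⊤

/-- The halved Fisher information `𝓘(γ) = ½ ∫₀¹ |∂E|²(γ_t) dt`. -/
def fisherInformation (E : X → EReal) (γ : Curve X) : ℝ≥0∞ :=
  2⁻¹ * ∫⁻ t in Icc (0 : ℝ) 1, metricSlope E (γ.ext t) ^ 2

/-- `𝓐_ε(γ) = 𝓐(γ) + ε² 𝓘(γ)`. -/
def schrodingerAction (E : X → EReal) (ε : ℝ) (γ : Curve X) : ℝ≥0∞ :=
  kineticAction γ + ENNReal.ofReal (ε ^ 2) * fisherInformation E γ

/-- The infimum of the kinetic action over the curves from `x` to `y`. -/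
def kineticCost (x y : X) : ℝ≥0∞ :=
  ⨅ (γ : Curve X) (_ : γ.Joins x y), kineticAction γ

/-- The optimal value of the `ε`-Schrödinger problem between `x` and `y`. -/
def schrodingerCost (E : X → EReal) (ε : ℝ) (x y : X) : ℝ≥0∞ :=
  ⨅ (γ : Curve X) (_ : γ.Joins x y), schrodingerAction E ε γ

/-- `ω` attains the infimum in the `ε`-Schrödinger problem between `x` and `y`. -/
def IsSchrodingerMinimizer (E : X → EReal) (ε : ℝ) (x y : X) (ω : Curve X) : Prop :=
  ω.Joins x y ∧ schrodingerAction E ε ω = schrodingerCost E ε x y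

/-- The `ε`-Schrödinger problem between `x` and `y` is solvable: its infimum is finite and attained. -/
def SchrodingerSolvable (E : X → EReal) (ε : ℝ) (x y : X) : Prop :=
  schrodingerCost E ε x y ≠ ⊤ ∧ ∃ ω : Curve X, IsSchrodingerMinimizer E ε x y ω

/-- Pointwise-in-time convergence of curves for the topology `σ`. -/
def PointwiseTendsto (σ : TopologicalSpace X) (ω : ℕ → Curve X) (ω₀ : Curve X) : Prop :=
  ∀ t : unitInterval, Tendsto (fun k => (ω k).pos t) atTop (@nhds X σ (ω₀.pos t))

end Problem

end

/-!
The lower bound is trivial, so everything rests on producing competitors of finite Fisher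
information whose kinetic action is almost minimal. The time-`s` map of the flow is
`e^{-lam s}`-Lipschitz and bounds the slope on compact sets, so it turns any curve of finite action
into one of finite Fisher information at the price of a factor close to `1` in the action and of a
small displacement of the endpoints. Endpoints of finite energy are reconnected by their own flow
trajectories, on which `|∂E|` is at most the metric speed and whose action is controlled by the drop
of `E`. Endpoints of infinite energy are first left along a short piece of the curve of finite
Fisher information that solvability provides. Minimizers then have bounded action, hence are
equi-Hölder of exponent `1/2`, and an Arzelà–Ascoli argument for `σ` together with the lower
semicontinuity of the action gives the limit curve.
-/

/-! ### Absolutely continuous curves in metric spaces -/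

section AbsolutelyContinuous

variable {X : Type*} [MetricSpace X] {γ : ℝ → X} {a b : ℝ}

theorem absolutelyContinuousOnInterval_dist (h : AbsolutelyContinuousOnInterval γ a b) (z : X) :
    AbsolutelyContinuousOnInterval (fun r => dist (γ r) z) a b := by
  refine squeeze_zero (fun _ => Finset.sum_nonneg fun _ _ => dist_nonneg)
    (fun _ => Finset.sum_le_sum fun _ _ => ?_) h
  rw [Real.dist_eq]
  exact abs_dist_sub_le _ _ _

theorem continuousOn_of_absolutelyContinuousOnInterval (h : AbsolutelyContinuousOnInterval γ a b) :
    ContinuousOn γ (uIcc a b) := by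
  intro t ht
  have hdist := (absolutelyContinuousOnInterval_dist h (γ t)).continuousOn t ht
  rw [ContinuousWithinAt, dist_self] at hdist
  exact tendsto_iff_dist_tendsto_zero.2 hdist

theorem absolutelyContinuousOnInterval_comp_add_const {c : ℝ}
    (h : AbsolutelyContinuousOnInterval γ (a + c) (b + c)) :
    AbsolutelyContinuousOnInterval (fun r => γ (r + c)) a b := by
  rw [absolutelyContinuousOnInterval_iff] at h ⊢
  intro ε hε
  obtain ⟨δ, hδ, hγ⟩ := h ε hε
  refine ⟨δ, hδ, fun ⟨n, I⟩ hI hlen => ?_⟩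
  refine hγ (n, fun i => ((I i).1 + c, (I i).2 + c)) ⟨fun i hi => ?_, fun i hi j hj hij => ?_⟩
    (by simpa only [dist_add_right] using hlen)
  · simp only [← image_add_const_uIcc]
    exact (hI.1 i hi).imp (mem_image_of_mem _) (mem_image_of_mem _)
  · have huIoc : ∀ p q : ℝ, uIoc (p + c) (q + c) = (fun r => r - c) ⁻¹' uIoc p q := by
      simp only [uIoc, preimage_sub_const_Ioc, min_add_add_right, max_add_add_right, implies_true]
    simp only [Function.onFun, huIoc]
    exact (hI.2 hi hj hij).preimage _

theorem le_of_ae_deriv_nonpos {φ : ℝ → ℝ} (hab : a ≤ b)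
    (h : AbsolutelyContinuousOnInterval φ a b)
    (hd : ∀ᵐ t, t ∈ Ioo a b → deriv φ t ≤ 0) : φ b ≤ φ a := by
  have hnonpos : ∫ t in a..b, deriv φ t ≤ 0 := by
    rw [intervalIntegral.integral_of_le hab, ← restrict_Ioo_eq_restrict_Ioc]
    exact integral_nonpos_of_ae ((ae_restrict_iff' measurableSet_Ioo).2 hd)
  rw [h.integral_deriv_eq_sub] at hnonpos
  exact sub_nonpos.1 hnonpos

end AbsolutelyContinuous

/-! ### Action controls -/

/-- A function `V` controls the action of `γ` on `[a, b]`: the increments of `V` dominate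
`∫ |γ'|²`, expressed through its Cauchy–Schwarz consequence `d(γ s, γ t)² ≤ |t - s| ∫ |γ'|²`.
Unlike the metric speed, this passes to pointwise limits. The inequality is written so that it is
symmetric in `s` and `t`. -/
def HasActionControl {X : Type*} [MetricSpace X] (γ : ℝ → X) (V : ℝ → ℝ) (a b : ℝ) : Prop :=
  ∀ s ∈ Icc a b, ∀ t ∈ Icc a b, dist (γ s) (γ t) ^ 2 ≤ (t - s) * (V t - V s)

theorem sum_abs_sub_le_of_monotoneOn {V : ℝ → ℝ} {a b : ℝ} (hab : a ≤ b)
    (hV : MonotoneOn V (Icc a b)) {n : ℕ} {I : ℕ → ℝ × ℝ}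
    (hI : (n, I) ∈ AbsolutelyContinuousOnInterval.disjWithin a b) :
    ∑ i ∈ Finset.range n, |V (I i).2 - V (I i).1| ≤ V b - V a := by
  obtain ⟨hmem, hdisj⟩ := hI
  rw [uIcc_of_le hab] at hmem
  dsimp only at hmem hdisj
  let l : ℕ → ℝ := fun i => min (I i).1 (I i).2
  let u : ℕ → ℝ := fun i => max (I i).1 (I i).2
  have hl : ∀ i ∈ Finset.range n, l i ∈ Icc a b := fun i hi =>
    inf_ind _ _ (hmem i hi).1 (hmem i hi).2
  have hu : ∀ i ∈ Finset.range n, u i ∈ Icc a b := fun i hi =>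
    sup_ind _ _ (hmem i hi).1 (hmem i hi).2
  have hVdisj : Set.PairwiseDisjoint (↑(Finset.range n)) fun i => Ioo (V (l i)) (V (u i)) := by
    intro i hi j hj hij
    have hlu : min (u i) (u j) ≤ max (l i) (l j) := Ioc_disjoint_Ioc.1 (hdisj hi hj hij)
    refine Ioo_disjoint_Ioo.2 ?_
    rw [← hV.map_min (hu i hi) (hu j hj), ← hV.map_max (hl i hi) (hl j hj)]
    exact hV (inf_ind _ _ (hu i hi) (hu j hj)) (sup_ind _ _ (hl i hi) (hl j hj)) hlu
  have hsub : (⋃ i ∈ Finset.range n, Ioo (V (l i)) (V (u i))) ⊆ Icc (V a) (V b) :=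
    iUnion₂_subset fun i hi => Ioo_subset_Icc_self.trans <| Icc_subset_Icc
      (hV (left_mem_Icc.2 hab) (hl i hi) (hl i hi).1)
      (hV (hu i hi) (right_mem_Icc.2 hab) (hu i hi).2)
  have hvol : ∀ i ∈ Finset.range n,
      volume (Ioo (V (l i)) (V (u i))) = ENNReal.ofReal |V (I i).2 - V (I i).1| := by
    intro i hi
    obtain ⟨h₁, h₂⟩ := hmem i hi
    rw [Real.volume_Ioo, hV.map_min h₁ h₂, hV.map_max h₁ h₂, max_sub_min_eq_abs]
  have hle := measure_mono (μ := volume) hsub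
  rw [measure_biUnion_finset hVdisj fun _ _ => measurableSet_Ioo, Finset.sum_congr rfl hvol,
    Real.volume_Icc, ← ENNReal.ofReal_sum_of_nonneg fun _ _ => abs_nonneg _] at hle
  exact (ENNReal.ofReal_le_ofReal_iff
    (sub_nonneg.2 (hV (left_mem_Icc.2 hab) (right_mem_Icc.2 hab) hab))).1 hle

theorem add_sq_le_add_mul_add {x y p q v w : ℝ} (hp : 0 ≤ p) (hq : 0 ≤ q) (hv : 0 ≤ v)
    (hw : 0 ≤ w) (hx : x ^ 2 ≤ p * v) (hy : y ^ 2 ≤ q * w) :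
    (x + y) ^ 2 ≤ (p + q) * (v + w) := by
  simpa [Fin.sum_univ_two] using
    Finset.sum_sq_le_sum_mul_sum_of_sq_le_mul Finset.univ (r := ![x, y]) (f := ![p, q])
      (g := ![v, w]) (by simp [hp, hq]) (by simp [hv, hw]) (by simp [hx, hy])

namespace HasActionControl

variable {X : Type*} [MetricSpace X] {γ γ' : ℝ → X} {V V' : ℝ → ℝ} {a b m : ℝ}

theorem of_lt (h : ∀ s ∈ Icc a b, ∀ t ∈ Icc a b, s < t →
    dist (γ s) (γ t) ^ 2 ≤ (t - s) * (V t - V s)) : HasActionControl γ V a b := by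
  intro s hs t ht
  rcases lt_trichotomy s t with hst | rfl | hst
  · exact h s hs t ht hst
  · simp
  · have := h t ht s hs hst
    rw [dist_comm]
    linarith

theorem monotoneOn (h : HasActionControl γ V a b) : MonotoneOn V (Icc a b) := by
  intro s hs t ht hst
  rcases hst.eq_or_lt with rfl | hst
  · exact le_rfl
  · exact sub_nonneg.1 <|
      nonneg_of_mul_nonneg_right ((sq_nonneg _).trans (h s hs t ht)) (sub_pos.2 hst)

theorem congr (h : HasActionControl γ V a b) (hγ : EqOn γ' γ (Icc a b))
    (hV : EqOn V' V (Icc a b)) : HasActionControl γ' V' a b := by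
  intro s hs t ht
  rw [hγ hs, hγ ht, hV hs, hV ht]
  exact h s hs t ht

theorem add_const (h : HasActionControl γ V a b) (c : ℝ) :
    HasActionControl γ (fun t => V t + c) a b := by
  simpa only [HasActionControl, add_sub_add_right_eq_sub] using h

theorem comp_affine {a' b' c e : ℝ} (h : HasActionControl γ V a b)
    (hm : MapsTo (fun t => c * t + e) (Icc a' b') (Icc a b)) :
    HasActionControl (fun t => γ (c * t + e)) (fun t => c * V (c * t + e)) a' b' := by
  intro s hs t ht
  refine (h _ (hm hs) _ (hm ht)).trans_eq ?_
  ring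

theorem lipschitz_comp {Y : Type*} [MetricSpace Y] {F : X → Y} {K : NNReal}
    (h : HasActionControl γ V a b) (hF : LipschitzWith K F) :
    HasActionControl (fun t => F (γ t)) (fun t => K ^ 2 * V t) a b := by
  intro s hs t ht
  calc dist (F (γ s)) (F (γ t)) ^ 2
      ≤ (K * dist (γ s) (γ t)) ^ 2 := by gcongr; exact hF.dist_le_mul _ _
    _ = K ^ 2 * dist (γ s) (γ t) ^ 2 := mul_pow _ _ _
    _ ≤ K ^ 2 * ((t - s) * (V t - V s)) := by gcongr; exact h s hs t ht
    _ = (t - s) * (K ^ 2 * V t - K ^ 2 * V s) := by ring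

theorem union (h₁ : HasActionControl γ V a m) (h₂ : HasActionControl γ V m b) :
    HasActionControl γ V a b := by
  refine of_lt fun s hs t ht hst => ?_
  rcases le_total t m with htm | hmt
  · exact h₁ s ⟨hs.1, hst.le.trans htm⟩ t ⟨ht.1, htm⟩
  rcases le_total m s with hms | hsm
  · exact h₂ s ⟨hms, hs.2⟩ t ⟨hmt, ht.2⟩
  have hs' : s ∈ Icc a m := ⟨hs.1, hsm⟩
  have hm : m ∈ Icc a m := ⟨hs.1.trans hsm, le_rfl⟩
  have hm' : m ∈ Icc m b := ⟨le_rfl, hmt.trans ht.2⟩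
  have ht' : t ∈ Icc m b := ⟨hmt, ht.2⟩
  calc dist (γ s) (γ t) ^ 2
      ≤ (dist (γ s) (γ m) + dist (γ m) (γ t)) ^ 2 := by gcongr; exact dist_triangle _ _ _
    _ ≤ ((m - s) + (t - m)) * ((V m - V s) + (V t - V m)) :=
        add_sq_le_add_mul_add (sub_nonneg.2 hsm) (sub_nonneg.2 hmt)
          (sub_nonneg.2 (h₁.monotoneOn hs' hm hsm)) (sub_nonneg.2 (h₂.monotoneOn hm' ht' hmt))
          (h₁ s hs' m hm) (h₂ m hm' t ht')
    _ = (t - s) * (V t - V s) := by ring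

theorem of_tendsto {ι : Type*} {l : Filter ι} [NeBot l] {Γ : ι → ℝ → X} {W : ι → ℝ → ℝ}
    (h : ∀ᶠ i in l, HasActionControl (Γ i) (W i) a b)
    (hW : ∀ t ∈ Icc a b, Tendsto (fun i => W i t) l (𝓝 (V t)))
    (hΓ : ∀ s ∈ Icc a b, ∀ t ∈ Icc a b, ∀ r < dist (γ s) (γ t),
      ∀ᶠ i in l, r < dist (Γ i s) (Γ i t)) :
    HasActionControl γ V a b := by
  intro s hs t ht
  have hlim : Tendsto (fun i => (t - s) * (W i t - W i s)) l (𝓝 ((t - s) * (V t - V s))) :=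
    ((hW t ht).sub (hW s hs)).const_mul _
  have hnonneg : 0 ≤ (t - s) * (V t - V s) :=
    ge_of_tendsto hlim (h.mono fun i hi => (sq_nonneg _).trans (hi s hs t ht))
  by_contra! hlt
  obtain ⟨r, hr, hr'⟩ := exists_between (Real.sqrt_lt_sqrt hnonneg hlt)
  rw [Real.sqrt_sq dist_nonneg] at hr'
  refine hr.not_ge (Real.le_sqrt_of_sq_le (ge_of_tendsto hlim ?_))
  filter_upwards [h, hΓ s hs t ht r hr'] with i hi hri
  exact (pow_le_pow_left₀ ((Real.sqrt_nonneg _).trans hr.le) hri.le 2).trans (hi s hs t ht)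

theorem absolutelyContinuousOnInterval (h : HasActionControl γ V a b) (hab : a ≤ b) :
    AbsolutelyContinuousOnInterval γ a b := by
  rw [absolutelyContinuousOnInterval_iff]
  intro ε hε
  have hVab : 0 ≤ V b - V a :=
    sub_nonneg.2 (h.monotoneOn (left_mem_Icc.2 hab) (right_mem_Icc.2 hab) hab)
  refine ⟨ε ^ 2 / (V b - V a + 1), by positivity, fun ⟨n, I⟩ hI hlen => ?_⟩
  have hmem := hI.1
  rw [uIcc_of_le hab] at hmem
  dsimp only at hlen hmem ⊢
  rw [lt_div_iff₀ (by positivity)] at hlen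
  refine lt_of_pow_lt_pow_left₀ 2 hε.le ?_
  calc (∑ i ∈ Finset.range n, dist (γ (I i).1) (γ (I i).2)) ^ 2
      ≤ (∑ i ∈ Finset.range n, dist (I i).1 (I i).2) *
          ∑ i ∈ Finset.range n, |V (I i).2 - V (I i).1| := by
        refine Finset.sum_sq_le_sum_mul_sum_of_sq_le_mul _ (fun _ _ => dist_nonneg)
          (fun _ _ => abs_nonneg _) fun i hi => ?_
        rw [dist_comm (I i).1, Real.dist_eq, ← abs_mul]
        exact (h _ (hmem i hi).1 _ (hmem i hi).2).trans (le_abs_self _)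
    _ ≤ (∑ i ∈ Finset.range n, dist (I i).1 (I i).2) * (V b - V a + 1) := by
        gcongr
        exact (sum_abs_sub_le_of_monotoneOn hab h.monotoneOn hI).trans (by linarith)
    _ < ε ^ 2 := hlen

theorem continuousOn (h : HasActionControl γ V a b) : ContinuousOn γ (Icc a b) := by
  rcases le_or_gt a b with hab | hab
  · rw [← uIcc_of_le hab]
    exact continuousOn_of_absolutelyContinuousOnInterval (h.absolutelyContinuousOnInterval hab)
  · simp [Icc_eq_empty_of_lt hab]

theorem metricSpeed_le_sqrt_deriv (h : HasActionControl γ V a b) {t : ℝ} (ht : t ∈ Ioo a b)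
    (hd : DifferentiableAt ℝ V t) : metricSpeed γ t ≤ ENNReal.ofReal √(deriv V t) := by
  have hlim : Tendsto (fun s => ENNReal.ofReal √(slope V t s)) (𝓝[≠] t)
      (𝓝 (ENNReal.ofReal √(deriv V t))) :=
    ENNReal.tendsto_ofReal ((Real.continuous_sqrt.tendsto _).comp hd.hasDerivAt.tendsto_slope)
  rw [← hlim.limsup_eq]
  refine limsup_le_limsup ?_
  filter_upwards [self_mem_nhdsWithin, mem_nhdsWithin_of_mem_nhds (Icc_mem_nhds ht.1 ht.2)]
    with s (hne : s ≠ t) hs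
  have hpos : 0 < dist s t := dist_pos.2 hne
  rw [edist_dist, edist_dist, ← ENNReal.ofReal_div_of_pos hpos]
  refine ENNReal.ofReal_le_ofReal (Real.le_sqrt_of_sq_le ?_)
  rw [div_pow, div_le_iff₀ (by positivity), slope_def_field, Real.dist_eq, sq_abs]
  refine (h s hs t (Ioo_subset_Icc_self ht)).trans_eq ?_
  have : s - t ≠ 0 := sub_ne_zero.2 hne
  field_simp
  ring

theorem lintegral_metricSpeed_sq_le (h : HasActionControl γ V a b) (hab : a ≤ b) :
    ∫⁻ t in Icc a b, metricSpeed γ t ^ 2 ≤ ENNReal.ofReal (V b - V a) := by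
  have hmono : MonotoneOn V (uIcc a b) := by rw [uIcc_of_le hab]; exact h.monotoneOn
  have hderiv : ∀ᵐ t ∂volume.restrict (Icc a b),
      0 ≤ deriv V t ∧ metricSpeed γ t ≤ ENNReal.ofReal √(deriv V t) := by
    rw [← restrict_Ioo_eq_restrict_Icc, ae_restrict_iff' measurableSet_Ioo]
    filter_upwards [h.monotoneOn.ae_differentiableWithinAt measurableSet_Icc |>
      (ae_restrict_iff' measurableSet_Icc).1] with t hdt ht
    have hnhds := Icc_mem_nhds ht.1 ht.2
    refine ⟨?_, h.metricSpeed_le_sqrt_deriv ht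
      ((hdt (Ioo_subset_Icc_self ht)).differentiableAt hnhds)⟩
    rw [← derivWithin_of_mem_nhds hnhds]
    exact h.monotoneOn.derivWithin_nonneg
  calc ∫⁻ t in Icc a b, metricSpeed γ t ^ 2
      ≤ ∫⁻ t in Icc a b, ENNReal.ofReal (deriv V t) := by
        refine lintegral_mono_ae (hderiv.mono fun t ht => ?_)
        calc metricSpeed γ t ^ 2 ≤ ENNReal.ofReal √(deriv V t) ^ 2 := by gcongr; exact ht.2
          _ = ENNReal.ofReal (deriv V t) := by
            rw [← ENNReal.ofReal_pow (Real.sqrt_nonneg _), Real.sq_sqrt ht.1]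
    _ = ENNReal.ofReal (∫ t in a..b, deriv V t) := by
        rw [intervalIntegral.integral_of_le hab, ← integral_Icc_eq_integral_Ioc]
        exact (ofReal_integral_eq_lintegral_ofReal
          ((intervalIntegrable_iff_integrableOn_Icc_of_le hab).1 hmono.intervalIntegrable_deriv)
          (hderiv.mono fun _ => And.left)).symm
    _ ≤ ENNReal.ofReal (V b - V a) := by
        have hint := hmono.intervalIntegral_deriv_mem_uIcc
        rw [uIcc_of_le (sub_nonneg.2
          (h.monotoneOn (left_mem_Icc.2 hab) (right_mem_Icc.2 hab) hab))] at hint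
        exact ENNReal.ofReal_le_ofReal hint.2

end HasActionControl

section KineticAction

variable {X : Type*} [MetricSpace X] {γ : ℝ → X} {a b : ℝ}

theorem enorm_deriv_dist_le_metricSpeed {z : X} {t : ℝ}
    (hd : DifferentiableAt ℝ (fun r => dist (γ r) z) t) :
    ‖deriv (fun r => dist (γ r) z) t‖ₑ ≤ metricSpeed γ t := by
  have hlim := (continuous_enorm.tendsto _).comp hd.hasDerivAt.tendsto_slope
  rw [← hlim.limsup_eq]
  refine limsup_le_limsup ?_
  filter_upwards [self_mem_nhdsWithin] with s (hne : s ≠ t)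
  rw [edist_dist, edist_dist, ← ENNReal.ofReal_div_of_pos (dist_pos.2 hne), Function.comp_apply,
    Real.enorm_eq_ofReal_abs, slope_def_field, abs_div, Real.dist_eq s t]
  exact ENNReal.ofReal_le_ofReal (by gcongr; exact abs_dist_sub_le _ _ _)

theorem edist_le_lintegral_metricSpeed (h : AbsolutelyContinuousOnInterval γ a b) (hab : a ≤ b) :
    ∃ f : ℝ → ℝ≥0∞, Measurable f ∧ (∀ᵐ r ∂volume.restrict (Ioc a b), f r ≤ metricSpeed γ r) ∧
      edist (γ a) (γ b) ≤ ∫⁻ r in Ioc a b, f r := by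
  have hac := absolutelyContinuousOnInterval_dist h (γ a)
  refine ⟨fun r => ‖deriv (fun r => dist (γ r) (γ a)) r‖ₑ, (measurable_deriv _).enorm, ?_, ?_⟩
  · rw [ae_restrict_iff' measurableSet_Ioc]
    filter_upwards [hac.ae_differentiableAt] with r hr hr'
    rw [uIcc_of_le hab] at hr
    exact enorm_deriv_dist_le_metricSpeed (hr (Ioc_subset_Icc_self hr'))
  · have hftc := hac.integral_deriv_eq_sub
    rw [dist_self, sub_zero, intervalIntegral.integral_of_le hab, dist_comm] at hftc
    rw [edist_dist, ← Real.enorm_eq_ofReal dist_nonneg, ← hftc]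
    exact enorm_integral_le_lintegral_enorm _

theorem sq_lintegral_le {α : Type*} [MeasurableSpace α] {μ : Measure α} {f : α → ℝ≥0∞}
    (hf : AEMeasurable f μ) : (∫⁻ r, f r ∂μ) ^ 2 ≤ μ univ * ∫⁻ r, f r ^ 2 ∂μ := by
  have hholder := ENNReal.lintegral_mul_le_Lp_mul_Lq μ Real.HolderConjugate.two_two hf
    (aemeasurable_const (b := (1 : ℝ≥0∞)))
  simp only [Pi.mul_apply, mul_one, ENNReal.rpow_two, one_pow, lintegral_one] at hholder
  calc (∫⁻ r, f r ∂μ) ^ 2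
      ≤ ((∫⁻ r, f r ^ 2 ∂μ) ^ (1 / 2 : ℝ) * μ univ ^ (1 / 2 : ℝ)) ^ 2 :=
        pow_le_pow_left' hholder 2
    _ = μ univ * ∫⁻ r, f r ^ 2 ∂μ := by
      rw [mul_pow, ← ENNReal.rpow_mul_natCast, ← ENNReal.rpow_mul_natCast]
      norm_num [mul_comm]

theorem edist_sq_le_lintegral_metricSpeed_sq (h : AbsolutelyContinuousOnInterval γ a b)
    (hab : a ≤ b) :
    edist (γ a) (γ b) ^ 2 ≤ ENNReal.ofReal (b - a) * ∫⁻ r in Ioc a b, metricSpeed γ r ^ 2 := by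
  obtain ⟨f, hf, hle, hdist⟩ := edist_le_lintegral_metricSpeed h hab
  calc edist (γ a) (γ b) ^ 2 ≤ (∫⁻ r in Ioc a b, f r) ^ 2 := by gcongr
    _ ≤ ENNReal.ofReal (b - a) * ∫⁻ r in Ioc a b, f r ^ 2 := by
        rw [← Real.volume_Ioc, ← Measure.restrict_apply_univ]
        exact sq_lintegral_le hf.aemeasurable
    _ ≤ ENNReal.ofReal (b - a) * ∫⁻ r in Ioc a b, metricSpeed γ r ^ 2 :=
        mul_le_mul_right (lintegral_mono_ae (hle.mono fun r hr => pow_le_pow_left' hr 2)) _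

theorem exists_hasActionControl (h : AbsolutelyContinuousOnInterval γ a b) (hab : a ≤ b)
    (hfin : ∫⁻ t in Icc a b, metricSpeed γ t ^ 2 ≠ ⊤) :
    ∃ V : ℝ → ℝ, HasActionControl γ V a b ∧ Continuous V ∧
      V b - V a = (∫⁻ t in Icc a b, metricSpeed γ t ^ 2).toReal := by
  let ν : Measure ℝ := (volume.restrict (Icc a b)).withDensity fun t => metricSpeed γ t ^ 2
  have : IsFiniteMeasure ν := isFiniteMeasure_withDensity hfin
  have : NullSingletonClass ν :=
    ⟨fun t => withDensity_absolutelyContinuous _ _ (by simp)⟩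
  have hint : ∀ s t, IntervalIntegrable (fun _ => (1 : ℝ)) ν s t := fun s t =>
    intervalIntegrable_const
  have hν : ∀ s ∈ Icc a b, ∀ t ∈ Icc a b,
      ν (Ioc s t) = ∫⁻ r in Ioc s t, metricSpeed γ r ^ 2 := by
    intro s hs t ht
    rw [withDensity_apply _ measurableSet_Ioc, Measure.restrict_restrict measurableSet_Ioc,
      inter_eq_left.2 (Ioc_subset_Icc_self.trans (Icc_subset_Icc hs.1 ht.2))]
  have hV : ∀ s t, s ≤ t →
      (∫ _ in a..t, (1 : ℝ) ∂ν) - ∫ _ in a..s, (1 : ℝ) ∂ν = ν.real (Ioc s t) := by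
    intro s t hst
    rw [intervalIntegral.integral_interval_sub_left (hint a t) (hint a s),
      intervalIntegral.integral_of_le hst]
    simp
  refine ⟨fun t => ∫ _ in a..t, (1 : ℝ) ∂ν, HasActionControl.of_lt fun s hs t ht hst => ?_,
    intervalIntegral.continuous_primitive hint a, ?_⟩
  · have hac : AbsolutelyContinuousOnInterval γ s t := h.mono <| by
      rw [uIcc_of_le hst.le, uIcc_of_le hab]
      exact Icc_subset_Icc hs.1 ht.2
    have hle := edist_sq_le_lintegral_metricSpeed_sq hac hst.le
    rw [← hν s hs t ht] at hle
    rw [hV s t hst.le]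
    have htop : ENNReal.ofReal (t - s) * ν (Ioc s t) ≠ ⊤ :=
      ENNReal.mul_ne_top ENNReal.ofReal_ne_top (measure_ne_top _ _)
    simpa [edist_dist, Measure.real, hst.le] using ENNReal.toReal_mono htop hle
  · rw [hV a b hab, Measure.real, hν a (left_mem_Icc.2 hab) b (right_mem_Icc.2 hab),
      restrict_Ioc_eq_restrict_Icc]

theorem exists_hasActionControl_of_kineticAction_ne_top {γ : Curve X} (h : kineticAction γ ≠ ⊤) :
    ∃ V : ℝ → ℝ, HasActionControl γ.ext V 0 1 ∧ Continuous V ∧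
      V 1 - V 0 = 2 * (kineticAction γ).toReal := by
  unfold kineticAction at h ⊢
  split_ifs at h ⊢ with hac
  · have hfin : ∫⁻ t in Icc (0 : ℝ) 1, metricSpeed γ.ext t ^ 2 ≠ ⊤ := fun htop => by
      simp [htop] at h
    obtain ⟨V, hV, hcont, heq⟩ := exists_hasActionControl hac zero_le_one hfin
    refine ⟨V, hV, hcont, ?_⟩
    rw [heq, ENNReal.toReal_mul]
    simp
  · exact absurd rfl h

theorem HasActionControl.kineticAction_le {γ : Curve X} {V : ℝ → ℝ}
    (h : HasActionControl γ.ext V 0 1) : kineticAction γ ≤ ENNReal.ofReal ((V 1 - V 0) / 2) := by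
  rw [kineticAction, if_pos (h.absolutelyContinuousOnInterval zero_le_one),
    ENNReal.ofReal_div_of_pos two_pos, ENNReal.div_eq_inv_mul, ENNReal.ofReal_ofNat]
  gcongr
  exact h.lintegral_metricSpeed_sq_le zero_le_one

end KineticAction

/-! ### Joining points by curves of controlled duration and action -/

/-- `x` and `y` are joined by a curve of duration at most `T` with `∫ |γ'|² ≤ A`, along which
`∫ g(γ)` is finite. The time interval is arbitrary but nondegenerate, so that the curve can be
reparametrized on `[0, 1]`. -/
def JoinedWithin {X : Type*} [MetricSpace X] (g : X → ℝ≥0∞) (T A : ℝ) (x y : X) : Prop :=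
  ∃ (γ : ℝ → X) (V : ℝ → ℝ) (a b : ℝ), a < b ∧ b - a ≤ T ∧ HasActionControl γ V a b ∧
    γ a = x ∧ γ b = y ∧ V b - V a ≤ A ∧ ∫⁻ t in Icc a b, g (γ t) ≠ ⊤

theorem setLIntegral_comp_affine_ne_top {f : ℝ → ℝ≥0∞} {s t : Set ℝ} {c e : ℝ} (hc : c ≠ 0)
    (hs : MeasurableSet s) (hm : MapsTo (fun r => c * r + e) s t) (hf : ∫⁻ r in t, f r ≠ ⊤) :
    ∫⁻ r in s, f (c * r + e) ≠ ⊤ := by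
  have hderiv : ∀ r ∈ s, HasDerivWithinAt (fun r => c * r + e) c s r := fun r _ => by
    simpa using (((hasDerivAt_id r).const_mul c).add_const e).hasDerivWithinAt
  have hinj : InjOn (fun r => c * r + e) s := fun p _ q _ hpq => by simpa [hc] using hpq
  have himage := ne_top_of_le_ne_top hf (lintegral_mono_set hm.image_subset)
  rw [lintegral_image_eq_lintegral_abs_deriv_mul hs hderiv hinj f,
    lintegral_const_mul' _ _ ENNReal.ofReal_ne_top] at himage
  intro htop
  rw [htop, ENNReal.mul_top (by simpa using hc)] at himage
  exact himage rfl

theorem eqOn_ite_le_Ici {α : Type*} {f g : ℝ → α} {m : ℝ} (h : f m = g m) :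
    EqOn (fun t => if t ≤ m then f t else g t) g (Ici m) := by
  intro t ht
  rcases (mem_Ici.1 ht).eq_or_lt with rfl | hlt
  · simpa using h
  · simp [hlt.not_ge]

theorem eqOn_ite_le_Iic {α : Type*} {f g : ℝ → α} {m : ℝ} :
    EqOn (fun t => if t ≤ m then f t else g t) f (Iic m) :=
  fun _ ht => if_pos ht

theorem HasActionControl.ite {X : Type*} [MetricSpace X] {γ γ' : ℝ → X} {V V' : ℝ → ℝ}
    {a b m : ℝ} (h : HasActionControl γ V a m) (h' : HasActionControl γ' V' m b)
    (hm : γ m = γ' m) :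
    HasActionControl (fun t => if t ≤ m then γ t else γ' t)
      (fun t => if t ≤ m then V t else V' t + (V m - V' m)) a b :=
  (h.congr (eqOn_ite_le_Iic.mono Icc_subset_Iic_self)
      (eqOn_ite_le_Iic.mono Icc_subset_Iic_self)).union
    ((h'.add_const (V m - V' m)).congr ((eqOn_ite_le_Ici hm).mono Icc_subset_Ici_self)
      ((eqOn_ite_le_Ici (by ring)).mono Icc_subset_Ici_self))

theorem exists_curve_eqOn {X : Type*} [MetricSpace X] {γ : ℝ → X}
    (h : ContinuousOn γ (Icc 0 1)) :
    ∃ ω : Curve X, ω.Joins (γ 0) (γ 1) ∧ EqOn ω.ext γ (Icc 0 1) :=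
  ⟨⟨fun t => γ t, continuousOn_iff_continuous_domRestrict.1 h⟩, ⟨rfl, rfl⟩,
    fun _ ht => IccExtend_of_mem _ _ ht⟩

namespace JoinedWithin

variable {X : Type*} [MetricSpace X] {g : X → ℝ≥0∞} {x y z : X} {T T' A A' : ℝ}

theorem mono (h : JoinedWithin g T A x y) (hT : T ≤ T') (hA : A ≤ A') :
    JoinedWithin g T' A' x y := by
  obtain ⟨γ, V, a, b, hab, hdur, hγ, hx, hy, hV, hg⟩ := h
  exact ⟨γ, V, a, b, hab, hdur.trans hT, hγ, hx, hy, hV.trans hA, hg⟩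

theorem forget (h : JoinedWithin g T A x y) : JoinedWithin 0 T A x y := by
  obtain ⟨γ, V, a, b, hab, hdur, hγ, hx, hy, hV, -⟩ := h
  exact ⟨γ, V, a, b, hab, hdur, hγ, hx, hy, hV, by simp⟩

theorem symm (h : JoinedWithin g T A x y) : JoinedWithin g T A y x := by
  obtain ⟨γ, V, a, b, hab, hdur, hγ, rfl, rfl, hV, hg⟩ := h
  have hm : MapsTo (fun t => -1 * t + 0) (Icc (-b) (-a)) (Icc a b) := fun t ht =>
    ⟨by linarith [ht.2], by linarith [ht.1]⟩
  refine ⟨_, _, -b, -a, neg_lt_neg hab, by linarith, hγ.comp_affine hm, by simp, by simp, ?_,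
    setLIntegral_comp_affine_ne_top (f := fun t => g (γ t)) (by norm_num) measurableSet_Icc hm hg⟩
  simp only [add_zero, neg_mul, one_mul, neg_neg]
  linarith

theorem trans (h : JoinedWithin g T A x y) (h' : JoinedWithin g T' A' y z) :
    JoinedWithin g (T + T') (A + A') x z := by
  obtain ⟨γ, V, a, b, hab, hdur, hγ, rfl, rfl, hV, hg⟩ := h
  obtain ⟨γ', V', a', b', hab', hdur', hγ', hx', rfl, hV', hg'⟩ := h'
  let c := b + (b' - a')
  have hbc : b < c := by linarith
  have hm : MapsTo (fun t => 1 * t + (a' - b)) (Icc b c) (Icc a' b') := fun t ht =>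
    ⟨by linarith [ht.1], by linarith [ht.2]⟩
  have hb : 1 * b + (a' - b) = a' := by ring
  have hc : 1 * c + (a' - b) = b' := by ring
  have hjoin : γ b = γ' (1 * b + (a' - b)) := by rw [hb, hx']
  refine ⟨_, _, a, c, hab.trans hbc, by linarith, hγ.ite (hγ'.comp_affine hm) hjoin, if_pos hab.le,
    by simp only [hbc.not_ge, if_false, hc], ?_, ?_⟩
  · simp only [hab.le, hbc.not_ge, if_true, if_false, hb, hc]
    linarith
  · rw [← Icc_union_Icc_eq_Icc hab.le hbc.le]
    refine ne_top_of_le_ne_top (ENNReal.add_ne_top.2 ⟨?_, ?_⟩) (lintegral_union_le _ _ _)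
    · exact (setLIntegral_congr_fun measurableSet_Icc
        ((eqOn_ite_le_Iic.mono Icc_subset_Iic_self).comp_left (g := g))).trans_ne hg
    · refine (setLIntegral_congr_fun measurableSet_Icc
        (((eqOn_ite_le_Ici hjoin).mono Icc_subset_Ici_self).comp_left (g := g))).trans_ne ?_
      exact setLIntegral_comp_affine_ne_top (f := fun t => g (γ' t)) one_ne_zero measurableSet_Icc
        hm hg'

theorem map (h : JoinedWithin 0 T A x y) {F : X → X} {K : NNReal} (hF : LipschitzWith K F)
    (hg : ∀ B : Set X, IsCompact B → ∃ M : ℝ≥0∞, M ≠ ⊤ ∧ ∀ p ∈ B, g (F p) ≤ M) :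
    JoinedWithin g T (K ^ 2 * A) (F x) (F y) := by
  obtain ⟨γ, V, a, b, hab, hdur, hγ, rfl, rfl, hV, -⟩ := h
  refine ⟨_, _, a, b, hab, hdur, hγ.lipschitz_comp hF, rfl, rfl, ?_, ?_⟩
  · rw [← mul_sub]
    gcongr
  · obtain ⟨M, hM, hle⟩ := hg _ (isCompact_Icc.image_of_continuousOn hγ.continuousOn)
    refine ne_top_of_le_ne_top ?_ (setLIntegral_mono measurable_const fun t ht =>
      hle _ (mem_image_of_mem γ ht))
    rw [setLIntegral_const, Real.volume_Icc]
    exact ENNReal.mul_ne_top hM ENNReal.ofReal_ne_top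

theorem exists_curve (h : JoinedWithin g T A x y) :
    ∃ ω : Curve X, ω.Joins x y ∧ kineticAction ω ≤ ENNReal.ofReal (T * A / 2) ∧
      ∫⁻ t in Icc (0 : ℝ) 1, g (ω.ext t) ≠ ⊤ := by
  obtain ⟨γ, V, a, b, hab, hdur, hγ, rfl, rfl, hV, hg⟩ := h
  have hm : MapsTo (fun t => (b - a) * t + a) (Icc 0 1) (Icc a b) := fun t ht =>
    ⟨by nlinarith [ht.1], by nlinarith [ht.2]⟩
  have hγ₁ := hγ.comp_affine hm
  obtain ⟨ω, hω, heq⟩ := exists_curve_eqOn hγ₁.continuousOn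
  refine ⟨ω, by simpa using hω,
    (hγ₁.congr heq fun _ _ => rfl).kineticAction_le.trans (ENNReal.ofReal_le_ofReal ?_), ?_⟩
  · have hVab : 0 ≤ V b - V a :=
      sub_nonneg.2 (hγ.monotoneOn (left_mem_Icc.2 hab.le) (right_mem_Icc.2 hab.le) hab.le)
    simp only [mul_zero, mul_one, zero_add, sub_add_cancel, ← mul_sub]
    have := mul_le_mul hdur hV hVab ((sub_pos.2 hab).le.trans hdur)
    linarith
  · refine (setLIntegral_congr_fun measurableSet_Icc (heq.comp_left (g := g))).trans_ne ?_
    exact setLIntegral_comp_affine_ne_top (f := fun t => g (γ t)) (sub_pos.2 hab).ne'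
      measurableSet_Icc hm hg

end JoinedWithin

/-! ### Evolution variational inequalities -/

theorem tendsto_exp_mul_nhdsGT_zero (c : ℝ) :
    Tendsto (fun t => Real.exp (c * t)) (𝓝[>] 0) (𝓝 1) := by
  have hc : Continuous fun t : ℝ => Real.exp (c * t) := by fun_prop
  simpa only [mul_zero, Real.exp_zero] using (hc.tendsto 0).mono_left nhdsWithin_le_nhds

/-- The primitive `∫₀ᵗ e^{lam r} dr`, which multiplies the energy gap in the integrated form of the
evolution variational inequality. -/
noncomputable def expPrimitive (lam t : ℝ) : ℝ := ∫ r in (0 : ℝ)..t, Real.exp (lam * r)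

theorem expPrimitive_zero (lam : ℝ) : expPrimitive lam 0 = 0 :=
  intervalIntegral.integral_same

theorem hasDerivAt_expPrimitive (lam t : ℝ) :
    HasDerivAt (expPrimitive lam) (Real.exp (lam * t)) t :=
  (Continuous.integral_hasStrictDerivAt (by fun_prop) 0 t).hasDerivAt

theorem contDiff_expPrimitive (lam : ℝ) : ContDiff ℝ 1 (expPrimitive lam) := by
  rw [contDiff_one_iff_deriv, funext fun t => (hasDerivAt_expPrimitive lam t).deriv]
  exact ⟨fun t => (hasDerivAt_expPrimitive lam t).differentiableAt, by fun_prop⟩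

theorem expPrimitive_pos (lam : ℝ) {t : ℝ} (ht : 0 < t) : 0 < expPrimitive lam t :=
  intervalIntegral.intervalIntegral_pos_of_pos
    (Continuous.intervalIntegrable (by fun_prop) _ _) (fun _ => Real.exp_pos _) ht

theorem expPrimitive_le {lam t : ℝ} (ht : 0 ≤ t) (ht₁ : t ≤ 1) :
    expPrimitive lam t ≤ Real.exp (lam * t) * (Real.exp |lam| * t) := by
  have hbound : ∀ r ∈ Icc 0 t, Real.exp (lam * r) ≤ Real.exp (lam * t) * Real.exp |lam| := by
    intro r hr
    rw [← Real.exp_add, Real.exp_le_exp]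
    nlinarith [neg_abs_le lam, abs_nonneg lam, hr.1, hr.2]
  calc expPrimitive lam t ≤ ∫ _ in (0 : ℝ)..t, Real.exp (lam * t) * Real.exp |lam| :=
        intervalIntegral.integral_mono_on ht (Continuous.intervalIntegrable (by fun_prop) _ _)
          intervalIntegrable_const hbound
    _ = Real.exp (lam * t) * (Real.exp |lam| * t) := by
        rw [intervalIntegral.integral_const, sub_zero, smul_eq_mul]; ring

theorem tendsto_expPrimitive_div (lam : ℝ) :
    Tendsto (fun t => expPrimitive lam t / t) (𝓝[>] 0) (𝓝 1) := by
  have hslope := (hasDerivAt_expPrimitive lam 0).tendsto_slope.mono_left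
    (nhdsWithin_mono 0 fun _ ht => ne_of_gt (mem_Ioi.1 ht))
  simpa [slope_fun_def_field, expPrimitive_zero] using hslope

/-- A lower semicontinuous functional with values in `ℝ ∪ {+∞}` that is not identically `+∞`. -/
structure IsProperLSC {X : Type*} [TopologicalSpace X] (E : X → EReal) : Prop where
  ne_bot : ∀ x, E x ≠ ⊥
  lsc : LowerSemicontinuous E
  exists_ne_top : ∃ x, E x ≠ ⊤

theorem IsProperLSC.coe_toReal {X : Type*} [TopologicalSpace X] {E : X → EReal}
    (hE : IsProperLSC E) {x : X} (hx : E x ≠ ⊤) : ((E x).toReal : EReal) = E x :=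
  EReal.coe_toReal hx (hE.ne_bot x)

namespace IsEVIFlow

variable {X : Type*} [MetricSpace X] {E : X → EReal} {lam s t : ℝ} {u : ℝ → X} {x z : X}

theorem continuousAt (hu : IsEVIFlow E lam u x) (ht : 0 < t) : ContinuousAt u t := by
  have hcont := continuousOn_of_absolutelyContinuousOnInterval
    (hu.locally_ac (t / 2) (t + 1) (by linarith) (by linarith))
  rw [uIcc_of_le (by linarith)] at hcont
  exact hcont.continuousAt (Icc_mem_nhds (by linarith) (by linarith))

theorem shift (hu : IsEVIFlow E lam u x) (hs : 0 < s) :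
    IsEVIFlow E lam (fun t => u (t + s)) (u s) where
  locally_ac a b ha hab := absolutelyContinuousOnInterval_comp_add_const
    (hu.locally_ac (a + s) (b + s) (by linarith) (by linarith))
  evi z := by
    have hevi := (measurePreserving_add_right volume s).quasiMeasurePreserving.ae
      ((ae_restrict_iff' measurableSet_Ioi).1 (hu.evi z))
    rw [ae_restrict_iff' measurableSet_Ioi]
    filter_upwards [hevi] with t ht ht₀
    rw [deriv_comp_add_const (fun r => dist (u r) z ^ 2)]
    exact ht (add_pos ht₀ hs)
  starts := by
    have hadd : Tendsto (· + s) (𝓝[>] 0) (𝓝 s) := by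
      rw [Tendsto, Filter.map_add_right_nhdsGT, zero_add]
      exact nhdsWithin_le_nhds
    exact (hu.continuousAt hs).tendsto.comp hadd

/-- The evolution variational inequality integrated against `e^{lam r} dr`. -/
theorem exp_mul_dist_sq_sub_le_of_forall (hE : IsProperLSC E) (hu : IsEVIFlow E lam u x)
    (hz : E z ≠ ⊤) {c : ℝ} (hs : 0 < s) (hst : s ≤ t) (hc : ∀ r ∈ Ioo s t, E z ≤ c + E (u r)) :
    Real.exp (lam * t) * dist (u t) z ^ 2 - Real.exp (lam * s) * dist (u s) z ^ 2 ≤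
      2 * c * (expPrimitive lam t - expPrimitive lam s) := by
  have hd : AbsolutelyContinuousOnInterval (fun r => dist (u r) z ^ 2) s t := by
    have hdist := absolutelyContinuousOnInterval_dist (hu.locally_ac s t hs hst) z
    simpa only [sq] using hdist.fun_mul hdist
  have hexp : AbsolutelyContinuousOnInterval (fun r => Real.exp (lam * r)) s t :=
    ContDiffOn.absolutelyContinuousOnInterval (ContDiff.contDiffOn (by fun_prop))
  have hprim : AbsolutelyContinuousOnInterval (expPrimitive lam) s t :=
    (contDiff_expPrimitive lam).contDiffOn.absolutelyContinuousOnInterval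
  have hdecr := le_of_ae_deriv_nonpos hst ((hexp.fun_mul hd).fun_sub (hprim.const_mul (2 * c))) (by
    filter_upwards [(ae_restrict_iff' measurableSet_Ioi).1 (hu.evi z), hd.ae_differentiableAt]
      with r hr hdr hrst
    set p := 1 / 2 * deriv (fun s : ℝ => dist (u s) z ^ 2) r + lam / 2 * dist (u r) z ^ 2 with hp
    have hevi : (p : EReal) + E (u r) ≤ E z := hr (hs.trans hrst.1)
    have hr_top : E (u r) ≠ ⊤ := fun htop => hz (top_le_iff.1 (by simpa [htop] using hevi))
    have hpc : p ≤ c := by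
      have hle := hevi.trans (hc r hrst)
      rw [← hE.coe_toReal hr_top] at hle
      exact le_of_add_le_add_right (a := (E (u r)).toReal) (by exact_mod_cast hle)
    rw [uIcc_of_le hst] at hdr
    have hd' := (hdr (Ioo_subset_Icc_self hrst)).hasDerivAt
    have hexp' : HasDerivAt (fun r => Real.exp (lam * r)) (Real.exp (lam * r) * lam) r := by
      simpa using ((hasDerivAt_id r).const_mul lam).exp
    rw [((hexp'.fun_mul hd').fun_sub ((hasDerivAt_expPrimitive lam r).const_mul (2 * c))).deriv]
    linear_combination 2 * Real.exp (lam * r) * hpc)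
  linear_combination hdecr

theorem energy_antitone (hE : IsProperLSC E) (hu : IsEVIFlow E lam u x) (hs : 0 < s)
    (hst : s ≤ t) : E (u t) ≤ E (u s) := by
  by_contra! hlt
  have hcont : ContinuousOn u (Icc s t) := fun r hr =>
    (hu.continuousAt (hs.trans_le hr.1)).continuousWithinAt
  have hclosed : IsClosed (Icc s t ∩ u ⁻¹' {p | E p ≤ E (u s)}) :=
    hcont.preimage_isClosed_of_isClosed isClosed_Icc (hE.lsc.isClosed_preimage _)
  -- The last time `m` at which the energy is at most `E (u s)`: the EVI centred at `u m` pins the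
  -- flow to `u m` afterwards.
  obtain ⟨m, ⟨hmst, hm : E (u m) ≤ E (u s)⟩, hlast⟩ :=
    (isCompact_Icc.of_isClosed_subset hclosed inter_subset_left).exists_isGreatest
      ⟨s, left_mem_Icc.2 hst, le_refl (E (u s))⟩
  have hm_le : ∀ r ∈ Ioo m t, E (u m) ≤ (0 : ℝ) + E (u r) := by
    intro r hr
    rw [EReal.coe_zero, zero_add]
    refine hm.trans (le_of_not_ge fun hrs => hr.1.not_ge (hlast ⟨?_, hrs⟩))
    exact ⟨hmst.1.trans hr.1.le, hr.2.le⟩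
  have hsq := hu.exp_mul_dist_sq_sub_le_of_forall hE (ne_top_of_le_ne_top hlt.ne_top hm)
    (hs.trans_le hmst.1) hmst.2 hm_le
  have htm : u t = u m := by
    rw [dist_self] at hsq
    have hexp := Real.exp_pos (lam * t)
    refine dist_eq_zero.1 (pow_eq_zero_iff two_ne_zero |>.1 (le_antisymm ?_ (sq_nonneg _)))
    exact nonpos_of_mul_nonpos_right (by linarith) hexp
  exact hlt.not_ge (htm ▸ hm)

theorem energy_ne_top (hE : IsProperLSC E) (hu : IsEVIFlow E lam u x) (ht : 0 < t) :
    E (u t) ≠ ⊤ := by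
  obtain ⟨z, hz⟩ := hE.exists_ne_top
  have hae : ∀ᵐ r ∂(volume.restrict (Ioo 0 t)), E (u r) ≠ ⊤ := by
    filter_upwards [ae_restrict_of_ae_restrict_of_subset Ioo_subset_Ioi_self (hu.evi z)]
      with r hr htop
    exact hz (top_le_iff.1 (by simpa only [htop, EReal.coe_add_top] using hr))
  have hne : (ae (volume.restrict (Ioo 0 t))).NeBot := by
    rw [ae_neBot, Ne, Measure.restrict_eq_zero, Real.volume_Ioo, sub_zero]
    exact (ENNReal.ofReal_pos.2 ht).ne'
  obtain ⟨r, hr, hrt⟩ := (hae.and (ae_restrict_mem measurableSet_Ioo)).exists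
  exact ne_top_of_le_ne_top hr (hu.energy_antitone hE hrt.1 hrt.2.le)

theorem exp_mul_dist_sq_sub_le (hE : IsProperLSC E) (hu : IsEVIFlow E lam u x)
    (hz : E z ≠ ⊤) (ht : 0 < t) :
    Real.exp (lam * t) * dist (u t) z ^ 2 - dist x z ^ 2 ≤
      2 * expPrimitive lam t * ((E z).toReal - (E (u t)).toReal) := by
  set c := (E z).toReal - (E (u t)).toReal with hc
  have hle : ∀ r, 0 < r → r ≤ t → E z ≤ c + E (u r) := by
    intro r hr hrt
    calc E z = c + E (u t) := by
          rw [← hE.coe_toReal hz, ← hE.coe_toReal (hu.energy_ne_top hE ht), ← EReal.coe_add, hc,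
            sub_add_cancel]
      _ ≤ c + E (u r) := by gcongr; exact hu.energy_antitone hE hr hrt
  have hev : ∀ᶠ s in 𝓝[>] (0 : ℝ),
      Real.exp (lam * t) * dist (u t) z ^ 2 - Real.exp (lam * s) * dist (u s) z ^ 2 ≤
        2 * c * (expPrimitive lam t - expPrimitive lam s) := by
    filter_upwards [Ioo_mem_nhdsGT ht] with s hs
    exact hu.exp_mul_dist_sq_sub_le_of_forall hE hz hs.1 hs.2.le
      fun r hr => hle r (hs.1.trans hr.1) hr.2.le
  have hdist := (hu.starts.dist (tendsto_const_nhds (x := z))).pow 2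
  have hprim : Tendsto (expPrimitive lam) (𝓝[>] 0) (𝓝 0) := by
    simpa only [expPrimitive_zero] using
      (hasDerivAt_expPrimitive lam 0).continuousAt.tendsto.mono_left nhdsWithin_le_nhds
  have hlim := le_of_tendsto_of_tendsto
    (tendsto_const_nhds.sub ((tendsto_exp_mul_nhdsGT_zero lam).mul hdist))
    (tendsto_const_nhds.mul (tendsto_const_nhds.sub hprim)) hev
  linear_combination hlim

theorem energy_le_start (hE : IsProperLSC E) (hu : IsEVIFlow E lam u x) (hx : E x ≠ ⊤)
    (ht : 0 < t) : (E (u t)).toReal ≤ (E x).toReal := by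
  have hsq := hu.exp_mul_dist_sq_sub_le hE hx ht
  rw [dist_self, zero_pow two_ne_zero, sub_zero] at hsq
  exact sub_nonneg.1 (nonneg_of_mul_nonneg_right (le_trans (by positivity) hsq)
    (mul_pos two_pos (expPrimitive_pos lam ht)))

theorem tendsto_energy (hE : IsProperLSC E) (hu : IsEVIFlow E lam u x) (hx : E x ≠ ⊤) :
    Tendsto (fun t => (E (u t)).toReal) (𝓝[>] 0) (𝓝 (E x).toReal) := by
  refine tendsto_order.2 ⟨fun a ha => ?_, fun a ha => ?_⟩
  · have hax : (a : EReal) < E x := by rw [← hE.coe_toReal hx]; exact_mod_cast ha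
    filter_upwards [hu.starts.eventually (hE.lsc x a hax), self_mem_nhdsWithin] with t hat ht
    rw [← hE.coe_toReal (hu.energy_ne_top hE ht)] at hat
    exact_mod_cast hat
  · filter_upwards [self_mem_nhdsWithin] with t ht
    exact (hu.energy_le_start hE hx ht).trans_lt ha

theorem dist_sq_le (hE : IsProperLSC E) (hu : IsEVIFlow E lam u x) (hx : E x ≠ ⊤) (ht : 0 < t)
    (ht₁ : t ≤ 1) :
    dist x (u t) ^ 2 ≤ t * (2 * Real.exp |lam| * ((E x).toReal - (E (u t)).toReal)) := by
  refine le_of_mul_le_mul_left ?_ (Real.exp_pos (lam * t))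
  have hsq := hu.exp_mul_dist_sq_sub_le hE hx ht
  rw [dist_self, dist_comm, zero_pow two_ne_zero, sub_zero] at hsq
  have hgap := sub_nonneg.2 (hu.energy_le_start hE hx ht)
  calc Real.exp (lam * t) * dist x (u t) ^ 2
      ≤ 2 * expPrimitive lam t * ((E x).toReal - (E (u t)).toReal) := hsq
    _ ≤ 2 * (Real.exp (lam * t) * (Real.exp |lam| * t)) * ((E x).toReal - (E (u t)).toReal) := by
        gcongr; exact expPrimitive_le ht.le ht₁
    _ = _ := by ring

theorem hasActionControl (hE : IsProperLSC E) (hu : IsEVIFlow E lam u x) (hs : 0 < s)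
    (hts : t ≤ s + 1) :
    HasActionControl u (fun r => -(2 * Real.exp |lam|) * (E (u r)).toReal) s t := by
  refine HasActionControl.of_lt fun a ha b hb hab => ?_
  have ha₀ := hs.trans_le ha.1
  have hdist := (hu.shift ha₀).dist_sq_le hE (hu.energy_ne_top hE ha₀) (sub_pos.2 hab)
    (by linarith [ha.1, hb.2])
  rw [sub_add_cancel] at hdist
  linear_combination hdist

end IsEVIFlow

namespace IsEVIFlow

variable {X : Type*} [MetricSpace X] {E : X → EReal} {lam s t : ℝ} {u v : ℝ → X} {x y z : X}

theorem exp_sq_mul_dist_sq_sub_le (hE : IsProperLSC E) (hu : IsEVIFlow E lam u x)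
    (hv : IsEVIFlow E lam v y) (hx : E x ≠ ⊤) (ht : 0 < t) :
    Real.exp (lam * t) ^ 2 * dist (u t) (v t) ^ 2 - dist x y ^ 2 ≤
      2 * expPrimitive lam t * ((Real.exp (lam * t) - 1) * ((E (v t)).toReal - (E (u t)).toReal) +
        ((E x).toReal - (E (u t)).toReal)) := by
  have hu_v := hu.exp_mul_dist_sq_sub_le hE (hv.energy_ne_top hE ht) ht
  have hv_x := hv.exp_mul_dist_sq_sub_le hE hx ht
  rw [dist_comm (v t), dist_comm y] at hv_x
  linear_combination Real.exp (lam * t) * hu_v + hv_x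

theorem eventually_div_lt (hE : IsProperLSC E) (hu : IsEVIFlow E lam u x)
    (hv : IsEVIFlow E lam v y) (hx : E x ≠ ⊤) (hy : E y ≠ ⊤) {r : ℝ} (hr : 0 < r) :
    ∀ᶠ t in 𝓝[>] (0 : ℝ),
      (Real.exp (lam * t) ^ 2 * dist (u t) (v t) ^ 2 - dist x y ^ 2) / t < r := by
  have hEu := hu.tendsto_energy hE hx
  have hlim := ((tendsto_expPrimitive_div lam).const_mul 2).mul
    ((((tendsto_exp_mul_nhdsGT_zero lam).sub_const 1).mul ((hv.tendsto_energy hE hy).sub hEu)).add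
      (hEu.const_sub (E x).toReal))
  simp only [sub_self, zero_mul, add_zero, mul_zero] at hlim
  filter_upwards [hlim.eventually_lt_const hr, self_mem_nhdsWithin] with t hlt ht
  refine lt_of_le_of_lt ?_ hlt
  rw [div_le_iff₀ ht]
  calc _ ≤ _ := hu.exp_sq_mul_dist_sq_sub_le hE hv hx ht
    _ = _ := by field_simp [(mem_Ioi.1 ht).ne']

theorem antitoneOn_exp_sq_mul_dist_sq (hE : IsProperLSC E) (hu : IsEVIFlow E lam u x)
    (hv : IsEVIFlow E lam v y) :
    AntitoneOn (fun t => Real.exp (lam * t) ^ 2 * dist (u t) (v t) ^ 2) (Ioi 0) := by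
  intro a ha b _ hab
  have hcont : ContinuousOn (fun t => Real.exp (lam * t) ^ 2 * dist (u t) (v t) ^ 2) (Icc a b) := by
    refine fun t ht => ContinuousAt.continuousWithinAt ?_
    have ht₀ : 0 < t := (mem_Ioi.1 ha).trans_le ht.1
    exact ((by fun_prop : ContinuousAt (fun t => Real.exp (lam * t)) t).pow 2).mul
      (((hu.continuousAt ht₀).dist (hv.continuousAt ht₀)).pow 2)
  refine image_le_of_liminf_slope_right_le_deriv_boundary hcont le_rfl continuousOn_const
    (fun t _ => hasDerivWithinAt_const t _ _) (fun t ht r hr => Eventually.frequently ?_)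
    (right_mem_Icc.2 hab)
  have ht₀ : 0 < t := (mem_Ioi.1 ha).trans_le ht.1
  have hexp : 0 < Real.exp (lam * t) ^ 2 := by positivity
  have hquot := (hu.shift ht₀).eventually_div_lt hE (hv.shift ht₀) (hu.energy_ne_top hE ht₀)
    (hv.energy_ne_top hE ht₀) (div_pos hr hexp)
  rw [← sub_self t, ← Filter.map_subRight_nhdsGT, eventually_map] at hquot
  filter_upwards [hquot] with s hs
  rw [lt_div_iff₀ hexp, sub_add_cancel] at hs
  rw [slope_def_field]
  refine lt_of_eq_of_lt ?_ hs
  have hsplit : Real.exp (lam * s) = Real.exp (lam * (s - t)) * Real.exp (lam * t) := by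
    rw [← Real.exp_add, ← mul_add, sub_add_cancel]
  rw [hsplit]
  ring

theorem exp_mul_dist_le (hE : IsProperLSC E) (hu : IsEVIFlow E lam u x)
    (hv : IsEVIFlow E lam v y) (ht : 0 < t) :
    Real.exp (lam * t) * dist (u t) (v t) ≤ dist x y := by
  have hlim : Tendsto (fun s => Real.exp (lam * s) ^ 2 * dist (u s) (v s) ^ 2) (𝓝[>] 0)
      (𝓝 (dist x y ^ 2)) := by
    simpa only [one_pow, one_mul] using
      ((tendsto_exp_mul_nhdsGT_zero lam).pow 2).mul ((hu.starts.dist hv.starts).pow 2)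
  refine (sq_le_sq₀ (by positivity) dist_nonneg).1 ?_
  rw [mul_pow]
  refine ge_of_tendsto hlim ?_
  filter_upwards [Ioo_mem_nhdsGT ht] with s hs
  exact hu.antitoneOn_exp_sq_mul_dist_sq hE hv hs.1 ht hs.2.le

theorem lipschitzWith (hE : IsProperLSC E) {U : X → ℝ → X}
    (hU : ∀ p, IsEVIFlow E lam (U p) p) (ht : 0 < t) :
    LipschitzWith (Real.exp (-(lam * t))).toNNReal fun p => U p t := by
  refine LipschitzWith.of_dist_le_mul fun p q => ?_
  rw [Real.coe_toNNReal _ (Real.exp_pos _).le, Real.exp_neg, ← div_eq_inv_mul,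
    le_div_iff₀' (Real.exp_pos _)]
  exact (hU p).exp_mul_dist_le hE (hU q) ht

theorem energy_sub_le_of_eventually (hE : IsProperLSC E) (hu : IsEVIFlow E lam u x)
    (hx : E x ≠ ⊤) {L : ℝ} (hL : ∀ᶠ t in 𝓝[>] (0 : ℝ), dist x (u t) ≤ L * t) (hz : E z ≠ ⊤) :
    (E x).toReal - (E z).toReal ≤ L * dist x z - lam / 2 * dist x z ^ 2 := by
  have hexp : Tendsto (fun t => (1 - Real.exp (lam * t)) / t) (𝓝[>] 0) (𝓝 (-lam)) := by
    have hderiv : HasDerivAt (fun r => Real.exp (lam * r)) lam 0 := by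
      simpa using ((hasDerivAt_id (0 : ℝ)).const_mul lam).exp
    have hslope := hderiv.tendsto_slope.mono_left
      (nhdsWithin_mono 0 fun _ ht => ne_of_gt (mem_Ioi.1 ht))
    refine hslope.neg.congr fun t => ?_
    rw [slope_def_field, mul_zero, Real.exp_zero, sub_zero, ← neg_div, neg_sub]
  have hdist : Tendsto (fun t => dist (u t) z) (𝓝[>] 0) (𝓝 (dist x z)) :=
    hu.starts.dist tendsto_const_nhds
  have hlower := ((tendsto_expPrimitive_div lam).const_mul 2).mul
    ((hu.tendsto_energy hE hx).sub_const (E z).toReal)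
  have hupper := ((hdist.const_add (dist x z)).const_mul L).add (hexp.mul (hdist.pow 2))
  have hle := le_of_tendsto_of_tendsto hlower hupper (by
    filter_upwards [hL, self_mem_nhdsWithin] with t hLt ht
    have hsq := hu.exp_mul_dist_sq_sub_le hE hz ht
    have hdiff : dist x z ^ 2 - dist (u t) z ^ 2 ≤ (dist x z + dist (u t) z) * (L * t) := by
      rw [sq_sub_sq]
      gcongr
      linarith [dist_triangle x (u t) z]
    rw [mem_Ioi] at ht
    calc _ = 2 * expPrimitive lam t * ((E (u t)).toReal - (E z).toReal) / t := by ring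
      _ ≤ ((dist x z + dist (u t) z) * (L * t) + (1 - Real.exp (lam * t)) * dist (u t) z ^ 2) / t :=
          by gcongr; linear_combination hsq + hdiff
      _ = _ := by field_simp)
  linear_combination hle / 2

theorem metricSlope_le_of_eventually (hE : IsProperLSC E) (hu : IsEVIFlow E lam u x)
    (hx : E x ≠ ⊤) {L : ℝ} (hL : ∀ᶠ t in 𝓝[>] (0 : ℝ), dist x (u t) ≤ L * t) :
    metricSlope E x ≤ ENNReal.ofReal L := by
  have hlim : Tendsto (fun z => ENNReal.ofReal (L + |lam| / 2 * dist x z)) (𝓝[≠] x)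
      (𝓝 (ENNReal.ofReal L)) := by
    have hcont : Continuous fun z => ENNReal.ofReal (L + |lam| / 2 * dist x z) :=
      ENNReal.continuous_ofReal.comp (by fun_prop)
    simpa only [dist_self, mul_zero, add_zero] using (hcont.tendsto x).mono_left nhdsWithin_le_nhds
  rw [metricSlope, if_neg hx]
  rcases (𝓝[≠] x).eq_or_neBot with hbot | hne
  · simp [hbot]
  refine (limsup_le_limsup ?_).trans hlim.limsup_eq.le
  filter_upwards [self_mem_nhdsWithin] with z hzx
  have hpos : 0 < dist x z := dist_pos.2 (Ne.symm hzx)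
  by_cases hz : E z = ⊤
  · simp [hz, EReal.sub_top]
  rw [← hE.coe_toReal hx, ← hE.coe_toReal hz, ← EReal.coe_sub,
    EReal.toENNReal_of_ne_top (EReal.coe_ne_top _), EReal.toReal_coe, edist_dist,
    ← ENNReal.ofReal_div_of_pos hpos]
  refine ENNReal.ofReal_le_ofReal ((div_le_iff₀ hpos).2 ?_)
  calc (E x).toReal - (E z).toReal
      ≤ L * dist x z - lam / 2 * dist x z ^ 2 := hu.energy_sub_le_of_eventually hE hx hL hz
    _ ≤ L * dist x z + |lam| / 2 * dist x z ^ 2 := by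
        rw [sub_eq_add_neg, ← neg_mul, ← neg_div]
        gcongr
        exact neg_le_abs lam
    _ = (L + |lam| / 2 * dist x z) * dist x z := by ring

theorem exp_mul_metricSlope_le_metricSpeed (hE : IsProperLSC E) (hu : IsEVIFlow E lam u x)
    (hs : 0 < s) (hst : s ≤ t) :
    ENNReal.ofReal (Real.exp (lam * (t - s))) * metricSlope E (u t) ≤ metricSpeed u s := by
  refine le_of_forall_gt_imp_ge_of_dense fun c hc => ?_
  rcases eq_or_ne c ⊤ with rfl | hc_top
  · exact le_top
  have hexp := Real.exp_pos (lam * (t - s))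
  have hquot := (eventually_lt_of_limsup_lt hc).filter_mono
    (nhdsWithin_mono s fun r hr => ne_of_gt (mem_Ioi.1 hr))
  rw [← zero_add s, ← Filter.map_add_right_nhdsGT, zero_add, eventually_map] at hquot
  have hslope := (hu.shift (hs.trans_le hst)).metricSlope_le_of_eventually hE
    (hu.energy_ne_top hE (hs.trans_le hst)) (L := c.toReal / Real.exp (lam * (t - s))) (by
      filter_upwards [hquot, self_mem_nhdsWithin] with r hr hr₀
      rw [mem_Ioi] at hr₀
      rw [edist_dist, edist_dist, Real.dist_eq, add_sub_cancel_right, abs_of_pos hr₀,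
        ← ENNReal.ofReal_div_of_pos hr₀, ENNReal.ofReal_lt_iff_lt_toReal (by positivity) hc_top,
        div_lt_iff₀ hr₀] at hr
      rw [div_mul_eq_mul_div, le_div_iff₀' hexp]
      refine le_trans ?_ hr.le
      rcases hst.eq_or_lt with rfl | hst
      · simp [dist_comm]
      have hcontr := (hu.shift hs).exp_mul_dist_le hE (hu.shift (add_pos hr₀ hs)) (sub_pos.2 hst)
      rw [sub_add_cancel, show t - s + (r + s) = r + t by ring] at hcontr
      rwa [dist_comm (u (r + s))])
  calc _ ≤ ENNReal.ofReal (Real.exp (lam * (t - s))) *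
        ENNReal.ofReal (c.toReal / Real.exp (lam * (t - s))) := by gcongr
    _ = c := by
        rw [← ENNReal.ofReal_mul hexp.le, mul_div_cancel₀ _ hexp.ne', ENNReal.ofReal_toReal hc_top]

end IsEVIFlow

/-! ### Regularization by the flow -/

theorem neg_abs_le_mul (c : ℝ) {r : ℝ} (hr : 0 ≤ r) (hr₁ : r ≤ 1) : -|c| ≤ c * r := by
  nlinarith [neg_abs_le c, abs_nonneg c]

theorem metricSpeed_congr {X : Type*} [MetricSpace X] {γ γ' : ℝ → X} {t : ℝ}
    (h : γ =ᶠ[𝓝 t] γ') : metricSpeed γ t = metricSpeed γ' t := by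
  refine limsup_congr ((h.filter_mono nhdsWithin_le_nhds).mono fun s hs => ?_)
  rw [hs, h.eq_of_nhds]

namespace IsEVIFlow

variable {X : Type*} [MetricSpace X] {E : X → EReal} {lam t : ℝ} {u : ℝ → X} {x z : X}

theorem joinedWithin (hE : IsProperLSC E) (hu : IsEVIFlow E lam u x) (hx : E x ≠ ⊤) (ht : 0 < t)
    (ht₁ : t ≤ 1) :
    JoinedWithin (fun p => metricSlope E p ^ 2) t
      (2 * Real.exp |lam| * ((E x).toReal - (E (u t)).toReal)) x (u t) := by
  let γ : ℝ → X := fun s => if 0 < s then u s else x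
  have hγ : ∀ s, 0 < s → γ s = u s := fun s hs => if_pos hs
  have hγ₀ : γ 0 = x := if_neg (lt_irrefl 0)
  set V : ℝ → ℝ := fun s => -(2 * Real.exp |lam|) * (E (γ s)).toReal with hV
  have hcontrol : HasActionControl γ V 0 t := by
    refine HasActionControl.of_lt fun r hr s hs hrs => ?_
    have hs₀ : 0 < s := hr.1.trans_lt hrs
    rcases hr.1.eq_or_lt with rfl | hr₀
    · simp only [hV, hγ s hs₀, hγ₀]
      linear_combination hu.dist_sq_le hE hx hs₀ (hs.2.trans ht₁)
    · simp only [hV, hγ s hs₀, hγ r hr₀]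
      exact hu.hasActionControl hE hr₀ (by linarith [hs.2] : s ≤ r + 1) r (left_mem_Icc.2 hrs.le)
        s (right_mem_Icc.2 hrs.le)
  refine ⟨γ, V, 0, t, ht, (sub_zero t).le, hcontrol, hγ₀, hγ t ht, ?_, ?_⟩
  · simp only [hV, hγ t ht, hγ₀]
    linarith
  · refine ne_top_of_le_ne_top ENNReal.ofReal_ne_top
      (le_trans ?_ (hcontrol.lintegral_metricSpeed_sq_le ht.le))
    rw [← restrict_Ioo_eq_restrict_Icc]
    refine setLIntegral_mono' measurableSet_Ioo fun s hs => ?_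
    have hspeed : metricSpeed γ s = metricSpeed u s :=
      metricSpeed_congr ((eventually_gt_nhds hs.1).mono hγ)
    have hslope : metricSlope E (u s) ≤ metricSpeed u s := by
      simpa using hu.exp_mul_metricSlope_le_metricSpeed hE hs.1 le_rfl
    rw [hspeed, hγ s hs.1]
    exact pow_le_pow_left' hslope 2

theorem mul_metricSlope_sq_le (hE : IsProperLSC E) (hu : IsEVIFlow E lam u x) (ht : 0 < t)
    (ht₁ : t ≤ 1) :
    (ENNReal.ofReal (Real.exp (-|lam|)) * metricSlope E (u t)) ^ 2 * ENNReal.ofReal (t / 2) ≤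
      ENNReal.ofReal (2 * Real.exp |lam| * ((E (u (t / 2))).toReal - (E (u t)).toReal)) := by
  have hspeed : ∀ s ∈ Icc (t / 2) t,
      (ENNReal.ofReal (Real.exp (-|lam|)) * metricSlope E (u t)) ^ 2 ≤ metricSpeed u s ^ 2 := by
    intro s hs
    refine pow_le_pow_left' (le_trans ?_ (hu.exp_mul_metricSlope_le_metricSpeed hE
      ((half_pos ht).trans_le hs.1) hs.2)) 2
    gcongr
    exact neg_abs_le_mul lam (sub_nonneg.2 hs.2) (by linarith [hs.1])
  have hcontrol := hu.hasActionControl hE (half_pos ht) (by linarith : t ≤ t / 2 + 1)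
  calc _ = ∫⁻ _ in Icc (t / 2) t,
        (ENNReal.ofReal (Real.exp (-|lam|)) * metricSlope E (u t)) ^ 2 := by
        rw [setLIntegral_const, Real.volume_Icc, sub_half]
    _ ≤ ∫⁻ s in Icc (t / 2) t, metricSpeed u s ^ 2 := setLIntegral_mono' measurableSet_Icc hspeed
    _ ≤ _ := hcontrol.lintegral_metricSpeed_sq_le (half_le_self ht.le)
    _ = _ := by congr 1; ring

theorem energy_le_add_div (hE : IsProperLSC E) (hu : IsEVIFlow E lam u x) (hz : E z ≠ ⊤)
    (ht : 0 < t) :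
    (E (u t)).toReal ≤ (E z).toReal + dist x z ^ 2 / (2 * expPrimitive lam t) := by
  have hprim := expPrimitive_pos lam ht
  rw [← sub_le_iff_le_add', le_div_iff₀ (by positivity)]
  have hsq : 0 ≤ Real.exp (lam * t) * dist (u t) z ^ 2 := by positivity
  linarith [hu.exp_mul_dist_sq_sub_le hE hz ht]

theorem exists_metricSlope_sq_le (hE : IsProperLSC E) {U : X → ℝ → X}
    (hU : ∀ p, IsEVIFlow E lam (U p) p) (ht : 0 < t) (ht₁ : t ≤ 1) {B : Set X}
    (hB : IsCompact B) : ∃ M : ℝ≥0∞, M ≠ ⊤ ∧ ∀ p ∈ B, metricSlope E (U p t) ^ 2 ≤ M := by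
  rcases B.eq_empty_or_nonempty with rfl | hB_ne
  · exact ⟨0, ENNReal.zero_ne_top, by simp⟩
  obtain ⟨z, hz⟩ := hE.exists_ne_top
  obtain ⟨R, hR⟩ := hB.isBounded.subset_closedBall z
  have hlsc : LowerSemicontinuous fun p => E (U p t) :=
    LowerSemicontinuous.comp hE.lsc (lipschitzWith hE hU ht).continuous
  obtain ⟨q, -, hq⟩ := (hlsc.lowerSemicontinuousOn B).exists_isMinOn hB_ne hB
  set C := 2 * Real.exp |lam| *
    ((E z).toReal + R ^ 2 / (2 * expPrimitive lam (t / 2)) - (E (U q t)).toReal) with hC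
  set κ := ENNReal.ofReal (Real.exp (-|lam|)) ^ 2 * ENNReal.ofReal (t / 2)
  have hκ₀ : κ ≠ 0 := by positivity
  refine ⟨ENNReal.ofReal C / κ, ENNReal.div_ne_top ENNReal.ofReal_ne_top hκ₀, fun p hp => ?_⟩
  rw [ENNReal.le_div_iff_mul_le (Or.inl hκ₀) (Or.inl (by finiteness))]
  calc metricSlope E (U p t) ^ 2 * κ
      = (ENNReal.ofReal (Real.exp (-|lam|)) * metricSlope E (U p t)) ^ 2 *
          ENNReal.ofReal (t / 2) := by ring
    _ ≤ _ := (hU p).mul_metricSlope_sq_le hE ht ht₁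
    _ ≤ ENNReal.ofReal C := by
      have hprim := expPrimitive_pos lam (half_pos ht)
      have hupper := (hU p).energy_le_add_div hE hz (half_pos ht)
      have hlower : (E (U q t)).toReal ≤ (E (U p t)).toReal :=
        EReal.toReal_le_toReal (hq hp) (hE.ne_bot _) ((hU p).energy_ne_top hE ht)
      have hpz : dist p z ≤ R := hR hp
      rw [hC]
      gcongr
      exact hupper.trans (by gcongr)

end IsEVIFlow

theorem JoinedWithin.regularize {X : Type*} [MetricSpace X] {E : X → EReal} {lam T A η : ℝ}
    {x y : X} (hE : IsProperLSC E) (hflow : ∀ p, ∃ u, IsEVIFlow E lam u p)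
    (h : JoinedWithin 0 T A x y) (hx : E x ≠ ⊤) (hy : E y ≠ ⊤) (hη : 0 < η) :
    JoinedWithin (fun p => metricSlope E p ^ 2) (T + η) (A + η) x y := by
  choose U hU using hflow
  have hgap : ∀ p, E p ≠ ⊤ → Tendsto
      (fun s => 2 * Real.exp |lam| * ((E p).toReal - (E (U p s)).toReal)) (𝓝[>] 0) (𝓝 0) := by
    intro p hp
    simpa using
      (((hU p).tendsto_energy hE hp).const_sub (E p).toReal).const_mul (2 * Real.exp |lam|)
  have hmid : Tendsto (fun s => Real.exp (-lam * s) ^ 2 * A) (𝓝[>] 0) (𝓝 A) := by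
    simpa using ((tendsto_exp_mul_nhdsGT_zero (-lam)).pow 2).mul_const A
  have haction := ((hgap x hx).add hmid).add (hgap y hy)
  rw [zero_add, add_zero] at haction
  obtain ⟨s, hsA, hs, hsη⟩ := ((haction.eventually_lt_const (lt_add_of_pos_right A hη)).and
    (Ioo_mem_nhdsGT (lt_min (half_pos hη) one_pos))).exists
  have hs₁ : s ≤ 1 := hsη.le.trans (min_le_right _ _)
  have hsη₂ : s ≤ η / 2 := hsη.le.trans (min_le_left _ _)
  have hmap := h.map (g := fun p => metricSlope E p ^ 2) (IsEVIFlow.lipschitzWith hE hU hs)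
    fun B hB => IsEVIFlow.exists_metricSlope_sq_le hE hU hs hs₁ hB
  rw [Real.coe_toNNReal _ (Real.exp_pos _).le, ← neg_mul] at hmap
  exact (((hU x).joinedWithin hE hx hs hs₁).trans hmap).trans
    ((hU y).joinedWithin hE hy hs hs₁).symm |>.mono (by linarith) hsA.le

/-! ### Approximation by curves of finite Fisher information -/

section Approximation

theorem frequently_ne_top_of_setLIntegral_ne_top {f : ℝ → ℝ≥0∞} {a b : ℝ} (hab : a < b)
    (hf : ∫⁻ t in Icc a b, f t ≠ ⊤) : ∃ᶠ t in 𝓝[>] a, f t ≠ ⊤ := by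
  intro hev
  obtain ⟨c, hc, hsub⟩ := (mem_nhdsGT_iff_exists_mem_Ioc_Ioo_subset hab).1 hev
  have htop : ∀ t ∈ Ioo a c, f t = ⊤ := fun t ht => not_not.1 (hsub ht)
  refine hf (top_le_iff.1 ?_)
  calc ⊤ = ∫⁻ t in Ioo a c, f t := by
        rw [setLIntegral_congr_fun measurableSet_Ioo htop, setLIntegral_const, Real.volume_Ioo,
          ENNReal.top_mul (by simpa using hc.1)]
    _ ≤ ∫⁻ t in Icc a b, f t :=
        lintegral_mono_set (Ioo_subset_Icc_self.trans (Icc_subset_Icc le_rfl hc.2))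

namespace HasActionControl

variable {X : Type*} [MetricSpace X] {γ : ℝ → X} {V : ℝ → ℝ} {g : X → ℝ≥0∞} {a b η : ℝ}

theorem exists_joinedWithin_left (h : HasActionControl γ V a b) (hab : a < b) (hV : Continuous V)
    (hg : ∫⁻ t in Icc a b, g (γ t) ≠ ⊤) (hη : 0 < η) :
    ∃ p, g p ≠ ⊤ ∧ JoinedWithin g η η (γ a) p := by
  have hnear : ∀ᶠ t in 𝓝[>] a, V t < V a + η :=
    (hV.continuousWithinAt (s := Ioi a) (x := a)).eventually_lt_const (lt_add_of_pos_right _ hη)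
  obtain ⟨τ, hτ, hVτ, haτ, hτη⟩ :=
    ((frequently_ne_top_of_setLIntegral_ne_top hab hg).and_eventually (hnear.and
      (Ioo_mem_nhdsGT (lt_min hab (lt_add_of_pos_right a hη))))).exists
  have hsub : Icc a τ ⊆ Icc a b := Icc_subset_Icc le_rfl (hτη.le.trans (min_le_left _ _))
  refine ⟨γ τ, hτ, γ, V, a, τ, haτ, ?_, fun s hs t ht => h s (hsub hs) t (hsub ht), rfl, rfl, ?_,
    ne_top_of_le_ne_top hg (lintegral_mono_set hsub)⟩
  · linarith [hτη.le.trans (min_le_right _ _)]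
  · linarith

theorem exists_joinedWithin_right (h : HasActionControl γ V a b) (hab : a < b) (hV : Continuous V)
    (hg : ∫⁻ t in Icc a b, g (γ t) ≠ ⊤) (hη : 0 < η) :
    ∃ p, g p ≠ ⊤ ∧ JoinedWithin g η η (γ b) p := by
  have hm : MapsTo (fun t => -1 * t + (a + b)) (Icc a b) (Icc a b) := fun t ht =>
    ⟨by linarith [ht.2], by linarith [ht.1]⟩
  simpa using (h.comp_affine hm).exists_joinedWithin_left hab (by fun_prop)
    (setLIntegral_comp_affine_ne_top (f := fun t => g (γ t)) (by norm_num) measurableSet_Icc hm hg)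
    hη

end HasActionControl

variable {X : Type*} [MetricSpace X] {E : X → EReal} {lam : ℝ} {x y : X}

theorem energy_ne_top_of_metricSlope_sq_ne_top {p : X} (h : metricSlope E p ^ 2 ≠ ⊤) :
    E p ≠ ⊤ := by
  intro hp
  simp [metricSlope, hp] at h

theorem Curve.ext_coe (γ : Curve X) (t : unitInterval) : γ.ext t = γ t :=
  IccExtend_val _ _ t

theorem Curve.Joins.ext_eq {γ : Curve X} (h : γ.Joins x y) : γ.ext 0 = x ∧ γ.ext 1 = y :=
  ⟨(γ.ext_coe 0).trans h.1, (γ.ext_coe 1).trans h.2⟩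

theorem Curve.Joins.joinedWithin {γ : Curve X} (hγ : γ.Joins x y) (h : kineticAction γ ≠ ⊤) :
    JoinedWithin 0 1 (2 * (kineticAction γ).toReal) x y := by
  obtain ⟨V, hV, -, heq⟩ := exists_hasActionControl_of_kineticAction_ne_top h
  exact ⟨γ.ext, V, 0, 1, one_pos, (sub_zero 1).le, hV, hγ.ext_eq.1, hγ.ext_eq.2, heq.le, by simp⟩

theorem JoinedWithin.of_fisherInformation_ne_top (hE : IsProperLSC E)
    (hflow : ∀ p, ∃ u, IsEVIFlow E lam u p) {γ₀ : Curve X} (hγ₀ : γ₀.Joins x y)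
    (hA₀ : kineticAction γ₀ ≠ ⊤) (hI₀ : fisherInformation E γ₀ ≠ ⊤) {T A η : ℝ}
    (h : JoinedWithin 0 T A x y) (hη : 0 < η) :
    JoinedWithin (fun p => metricSlope E p ^ 2) (T + 5 * η) (A + 5 * η) x y := by
  obtain ⟨V, hV, hcont, -⟩ := exists_hasActionControl_of_kineticAction_ne_top hA₀
  have hg : ∫⁻ t in Icc (0 : ℝ) 1, metricSlope E (γ₀.ext t) ^ 2 ≠ ⊤ := fun htop => by
    simp [fisherInformation, htop] at hI₀
  obtain ⟨p, hp, hxp⟩ := hV.exists_joinedWithin_left (g := fun p => metricSlope E p ^ 2)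
    one_pos hcont hg hη
  obtain ⟨q, hq, hyq⟩ := hV.exists_joinedWithin_right (g := fun p => metricSlope E p ^ 2)
    one_pos hcont hg hη
  rw [hγ₀.ext_eq.1] at hxp
  rw [hγ₀.ext_eq.2] at hyq
  have hpq := ((hxp.forget.symm.trans h).trans hyq.forget).regularize hE hflow
    (energy_ne_top_of_metricSlope_sq_ne_top hp) (energy_ne_top_of_metricSlope_sq_ne_top hq) hη
  exact ((hxp.trans hpq).trans hyq.symm).mono (by linarith) (by linarith)

theorem exists_curve_kineticAction_lt (hE : IsProperLSC E)
    (hflow : ∀ p, ∃ u, IsEVIFlow E lam u p) {γ₀ γ : Curve X} (hγ₀ : γ₀.Joins x y)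
    (hA₀ : kineticAction γ₀ ≠ ⊤) (hI₀ : fisherInformation E γ₀ ≠ ⊤) (hγ : γ.Joins x y)
    {c : ℝ≥0∞} (hc : kineticAction γ < c) :
    ∃ ω : Curve X, ω.Joins x y ∧ kineticAction ω < c ∧ fisherInformation E ω ≠ ⊤ := by
  set A := 2 * (kineticAction γ).toReal with hA
  have hlim : Tendsto (fun η : ℝ => ENNReal.ofReal ((1 + 5 * η) * (A + 5 * η) / 2)) (𝓝[>] 0)
      (𝓝 (kineticAction γ)) := by
    have hcont : Continuous fun η : ℝ => (1 + 5 * η) * (A + 5 * η) / 2 := by fun_prop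
    simpa [hA, ENNReal.ofReal_toReal hc.ne_top] using
      ENNReal.tendsto_ofReal ((hcont.tendsto 0).mono_left nhdsWithin_le_nhds)
  obtain ⟨η, hηc, hη⟩ := ((hlim.eventually_lt_const hc).and self_mem_nhdsWithin).exists
  obtain ⟨ω, hω, hωA, hωI⟩ := (JoinedWithin.of_fisherInformation_ne_top hE hflow hγ₀ hA₀ hI₀
    (hγ.joinedWithin hc.ne_top) hη).exists_curve
  exact ⟨ω, hω, hωA.trans_lt hηc, ENNReal.mul_ne_top (by simp) hωI⟩

theorem kineticCost_le_schrodingerCost (E : X → EReal) (ε : ℝ) (x y : X) :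
    kineticCost x y ≤ schrodingerCost E ε x y :=
  iInf₂_mono fun _ _ => le_self_add

theorem tendsto_schrodingerAction {γ : Curve X} (h : fisherInformation E γ ≠ ⊤) {ι : Type*}
    {l : Filter ι} {ε : ι → ℝ} (hε : Tendsto ε l (𝓝 0)) :
    Tendsto (fun k => schrodingerAction E (ε k) γ) l (𝓝 (kineticAction γ)) := by
  have hsq : Tendsto (fun k => ENNReal.ofReal (ε k ^ 2)) l (𝓝 0) := by
    simpa using ENNReal.tendsto_ofReal (hε.pow 2)
  simpa [schrodingerAction] using
    (ENNReal.Tendsto.mul_const hsq (Or.inr h)).const_add (kineticAction γ)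

theorem exists_joins_of_schrodingerCost_ne_top {ε : ℝ} (hε : ε ≠ 0)
    (h : schrodingerCost E ε x y ≠ ⊤) : ∃ γ : Curve X,
      γ.Joins x y ∧ kineticAction γ ≠ ⊤ ∧ fisherInformation E γ ≠ ⊤ := by
  obtain ⟨γ, hγ, hfin⟩ : ∃ γ : Curve X, γ.Joins x y ∧ schrodingerAction E ε γ ≠ ⊤ := by
    simpa [schrodingerCost] using h
  obtain ⟨hA, hI⟩ := ENNReal.add_ne_top.1 hfin
  refine ⟨γ, hγ, hA, fun htop => hI ?_⟩
  rw [htop, ENNReal.mul_top (by simpa using hε)]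

theorem tendsto_schrodingerCost (hE : IsProperLSC E) (hflow : ∀ p, ∃ u, IsEVIFlow E lam u p)
    {ε₀ : ℝ} (hε₀ : ε₀ ≠ 0) (hcost : schrodingerCost E ε₀ x y ≠ ⊤) {ι : Type*} {l : Filter ι}
    {ε : ι → ℝ} (hε : Tendsto ε l (𝓝 0)) :
    Tendsto (fun k => schrodingerCost E (ε k) x y) l (𝓝 (kineticCost x y)) := by
  obtain ⟨γ₀, hγ₀, hA₀, hI₀⟩ := exists_joins_of_schrodingerCost_ne_top hε₀ hcost
  refine tendsto_order.2 ⟨fun a ha => Eventually.of_forall fun k =>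
    ha.trans_le (kineticCost_le_schrodingerCost E (ε k) x y), fun a ha => ?_⟩
  obtain ⟨γ, hγ, hγa⟩ : ∃ γ : Curve X, γ.Joins x y ∧ kineticAction γ < a := by
    simpa [kineticCost, iInf_lt_iff] using ha
  obtain ⟨ω, hω, hωa, hωI⟩ := exists_curve_kineticAction_lt hE hflow hγ₀ hA₀ hI₀ hγ hγa
  exact ((tendsto_schrodingerAction hωI hε).eventually_lt_const hωa).mono fun k hk =>
    (iInf₂_le ω hω).trans_lt hk

end Approximation

/-! ### Compactness for the weak topology -/

/-- The part of the assumptions on the auxiliary topology `σ` that concerns only the distance: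
metrically bounded sequences are sequentially `σ`-compact and `dist` is jointly sequentially
`σ`-lower semicontinuous. -/
structure IsWeakTopology {X : Type*} [MetricSpace X] (σ : TopologicalSpace X) : Prop where
  bounded_seq_compact : ∀ u : ℕ → X, Bornology.IsBounded (range u) →
    ∃ (z : X) (φ : ℕ → ℕ), StrictMono φ ∧ Tendsto (fun n => u (φ n)) atTop (@nhds X σ z)
  dist_lsc : ∀ (u v : ℕ → X) (a b : X), Tendsto u atTop (@nhds X σ a) →
    Tendsto v atTop (@nhds X σ b) → edist a b ≤ liminf (fun n => edist (u n) (v n)) atTop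

-- Cantor's diagonal argument: the filters generated by the successive subsequences decrease, and
-- their infimum is still countably generated, hence contains a subsequence.
theorem exists_strictMono_forall_tendsto_of_subseq {α ι : Type*} (u : ℕ → ℕ → α) (F : ι → Filter α)
    (h : ∀ (i : ℕ) (φ : ℕ → ℕ), StrictMono φ →
      ∃ (z : ι) (ψ : ℕ → ℕ), StrictMono ψ ∧ Tendsto (fun n => u i (φ (ψ n))) atTop (F z)) :
    ∃ φ : ℕ → ℕ, StrictMono φ ∧ ∀ i, ∃ z, Tendsto (fun n => u i (φ n)) atTop (F z) := by
  choose! z ψ hψ hlim using h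
  let Φ : ℕ → ℕ → ℕ := fun n => Nat.rec id (fun i φ => φ ∘ ψ i φ) n
  have hΦ : ∀ n, StrictMono (Φ n) := by
    intro n
    induction n with
    | zero => exact strictMono_id
    | succ i ih => exact ih.comp (hψ i _ ih)
  let l : ℕ → Filter ℕ := fun n => map (Φ n) atTop
  have hl : Antitone l := antitone_nat_of_succ_le fun i => by
    calc l (i + 1) = map (Φ i) (map (ψ i (Φ i)) atTop) := map_map.symm
      _ ≤ l i := map_mono (hψ i _ (hΦ i)).tendsto_atTop
  let L : Filter ℕ := ⨅ n, l n
  have hL : NeBot L := iInf_neBot_of_directed hl.directed_ge fun n => map_neBot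
  have hcountable : ∀ n, (l n).IsCountablyGenerated := fun n => map.isCountablyGenerated _ _
  have hLcountable : L.IsCountablyGenerated := @iInf.isCountablyGenerated _ _ _ l hcountable
  have hle : L ≤ atTop := iInf_le l 0
  obtain ⟨φ, hφ, hφL⟩ := subseq_tendsto_of_neBot (f := L) (u := id)
    (by rwa [map_id, inf_eq_left.2 hle])
  exact ⟨φ, hφ, fun i => ⟨_,
    (tendsto_map'_iff.2 (hlim i _ (hΦ i))).comp (hφL.mono_right (iInf_le l (i + 1)))⟩⟩

namespace IsWeakTopology

variable {X : Type*} [MetricSpace X] {σ : TopologicalSpace X} {u v : ℕ → X} {a b : X} {r : ℝ}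

theorem eventually_lt_dist (hσ : IsWeakTopology σ) (hu : Tendsto u atTop (@nhds X σ a))
    (hv : Tendsto v atTop (@nhds X σ b)) (hr : r < dist a b) :
    ∀ᶠ n in atTop, r < dist (u n) (v n) := by
  rcases lt_or_ge r 0 with hr₀ | hr₀
  · exact Eventually.of_forall fun n => hr₀.trans_le dist_nonneg
  have hliminf : ENNReal.ofReal r < liminf (fun n => edist (u n) (v n)) atTop := by
    refine lt_of_lt_of_le ?_ (hσ.dist_lsc u v a b hu hv)
    rwa [edist_dist, ENNReal.ofReal_lt_ofReal_iff_of_nonneg hr₀]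
  filter_upwards [eventually_lt_of_lt_liminf hliminf] with n hn
  rwa [edist_dist, ENNReal.ofReal_lt_ofReal_iff_of_nonneg hr₀] at hn

theorem dist_le (hσ : IsWeakTopology σ) (hu : Tendsto u atTop (@nhds X σ a))
    (hv : Tendsto v atTop (@nhds X σ b)) (hr : ∀ n, dist (u n) (v n) ≤ r) : dist a b ≤ r := by
  by_contra! hlt
  obtain ⟨n, hn⟩ := (hσ.eventually_lt_dist hu hv hlt).exists
  exact hn.not_ge (hr n)

theorem eq_of_tendsto (hσ : IsWeakTopology σ) (ha : Tendsto u atTop (@nhds X σ a))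
    (hb : Tendsto u atTop (@nhds X σ b)) : a = b :=
  dist_le_zero.1 (hσ.dist_le ha hb fun _ => (dist_self _).le)

theorem uniformContinuous_of_tendsto {T : Type*} [PseudoMetricSpace T] {ω : ℕ → T → X} {Ω : T → X}
    (hσ : IsWeakTopology σ) (hω : UniformEquicontinuous ω)
    (hΩ : ∀ t, Tendsto (fun n => ω n t) atTop (@nhds X σ (Ω t))) : UniformContinuous Ω := by
  refine Metric.uniformContinuous_iff.2 fun ε hε => ?_
  obtain ⟨δ, hδ, hδω⟩ := Metric.uniformEquicontinuous_iff.1 hω (ε / 2) (half_pos hε)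
  exact ⟨δ, hδ, fun s t hst => (hσ.dist_le (hΩ s) (hΩ t) fun n => (hδω s t hst n).le).trans_lt
    (half_lt_self hε)⟩

-- The diagonal subsequence converges at the points of a dense sequence; by equicontinuity its limit
-- points at any other time are at zero distance.
theorem exists_strictMono_forall_tendsto {T : Type*} [TopologicalSpace T]
    [TopologicalSpace.SeparableSpace T] [Nonempty T] {ω : ℕ → T → X} (hσ : IsWeakTopology σ)
    (hω : Equicontinuous ω)
    (hbdd : ∀ t, Bornology.IsBounded (range fun n => ω n t)) :
    ∃ φ : ℕ → ℕ, StrictMono φ ∧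
      ∀ t, ∃ z, Tendsto (fun n => ω (φ n) t) atTop (@nhds X σ z) := by
  have hcompact : ∀ (t : T) (φ : ℕ → ℕ), ∃ (z : X) (ψ : ℕ → ℕ), StrictMono ψ ∧
      Tendsto (fun n => ω (φ (ψ n)) t) atTop (@nhds X σ z) := fun t φ =>
    hσ.bounded_seq_compact (fun n => ω (φ n) t) ((hbdd t).subset
      (range_comp_subset_range φ fun n => ω n t))
  obtain ⟨φ, hφ, hlim⟩ := exists_strictMono_forall_tendsto_of_subseq
    (fun i n => ω n (TopologicalSpace.denseSeq T i)) (fun z => @nhds X σ z)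
    fun i φ _ => hcompact _ φ
  refine ⟨φ, hφ, fun t => ?_⟩
  obtain ⟨z, ψ, hψ, hz⟩ := hcompact t φ
  refine ⟨z, tendsto_of_subseq_tendsto fun ns hns => ?_⟩
  obtain ⟨z', ms, hms, hz'⟩ := hcompact t (φ ∘ ns)
  refine ⟨ms, ?_⟩
  suffices h : ∀ δ > 0, dist z z' ≤ δ + δ by
    have hzero : dist z z' ≤ 0 := le_of_forall_pos_le_add fun δ hδ => by
      linarith [h (δ / 2) (half_pos hδ)]
    rwa [dist_le_zero.1 hzero]
  intro δ hδ
  obtain ⟨_, ⟨i, rfl⟩, hi⟩ := ((mem_closure_iff_frequently.1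
    (TopologicalSpace.denseRange_denseSeq T t)).and_eventually
      (Metric.equicontinuousAt_iff_right.1 (hω t) δ hδ)).exists
  obtain ⟨w, hw⟩ := hlim i
  calc dist z z' ≤ dist z w + dist z' w := dist_triangle_right _ _ _
    _ ≤ δ + δ := add_le_add (hσ.dist_le hz (hw.comp hψ.tendsto_atTop) fun n => (hi _).le)
      (hσ.dist_le hz' (hw.comp (hns.comp hms.tendsto_atTop)) fun n => (hi _).le)

end IsWeakTopology

theorem HasActionControl.exists_of_forall_sub_le {X ι : Type*} [MetricSpace X] {l : Filter ι}
    [NeBot l] {γ : ℝ → X} {Γ : ι → ℝ → X} {V : ι → ℝ → ℝ} {a b A : ℝ} (hab : a ≤ b)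
    (h : ∀ i, HasActionControl (Γ i) (V i) a b) (hA : ∀ i, V i b - V i a ≤ A)
    (hΓ : ∀ s ∈ Icc a b, ∀ t ∈ Icc a b, ∀ r < dist (γ s) (γ t),
      ∀ᶠ i in l, r < dist (Γ i s) (Γ i t)) :
    ∃ W : ℝ → ℝ, HasActionControl γ W a b ∧ W b - W a ≤ A := by
  have ha : a ∈ Icc a b := left_mem_Icc.2 hab
  have hb : b ∈ Icc a b := right_mem_Icc.2 hab
  have hmem : ∀ t ∈ Icc a b, ∀ i, V i t - V i a ∈ Icc 0 A := fun t ht i =>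
    ⟨sub_nonneg.2 ((h i).monotoneOn ha ht ht.1),
      (sub_le_sub_right ((h i).monotoneOn ht hb ht.2) _).trans (hA i)⟩
  have hlim : ∀ t ∈ Icc a b,
      ∃ w ∈ Icc 0 A, Tendsto (fun i => V i t - V i a) (Ultrafilter.of l : Filter ι) (𝓝 w) :=
    fun t ht => isCompact_Icc.ultrafilter_le_nhds ((Ultrafilter.of l).map fun i => V i t - V i a)
      (tendsto_principal.2 (Eventually.of_forall (hmem t ht)))
  choose! W hWA hW using hlim
  refine ⟨W, HasActionControl.of_tendsto (Eventually.of_forall fun i => (h i).add_const (-V i a)) hW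
    fun s hs t ht r hr => Ultrafilter.of_le l (hΓ s hs t ht r hr), ?_⟩
  linarith [(hWA b hb).2, (hWA a ha).1]

section CompactnessOfCurves

theorem exists_curve_coe_eq {X : Type*} [MetricSpace X] {Ω : unitInterval → X}
    (h : UniformContinuous Ω) : ∃ γ : Curve X, ⇑γ = Ω :=
  ⟨⟨Ω, h.continuous⟩, rfl⟩

variable {X : Type*} [MetricSpace X] {σ : TopologicalSpace X} {x y : X}

theorem dist_sq_le_kineticAction_mul {γ : Curve X} (h : kineticAction γ ≠ ⊤) (s t : unitInterval) :
    dist (γ s) (γ t) ^ 2 ≤ 2 * (kineticAction γ).toReal * dist s t := by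
  obtain ⟨V, hV, -, heq⟩ := exists_hasActionControl_of_kineticAction_ne_top h
  have hosc : |V t - V s| ≤ V 1 - V 0 := by
    have hmono := hV.monotoneOn
    have h₀ : (0 : ℝ) ∈ Icc (0 : ℝ) 1 := left_mem_Icc.2 zero_le_one
    have h₁ : (1 : ℝ) ∈ Icc (0 : ℝ) 1 := right_mem_Icc.2 zero_le_one
    exact abs_sub_le_of_le_of_le (hmono h₀ t.2 t.2.1) (hmono t.2 h₁ t.2.2)
      (hmono h₀ s.2 s.2.1) (hmono s.2 h₁ s.2.2)
  calc dist (γ s) (γ t) ^ 2 ≤ (t - s) * (V t - V s) := by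
        simpa only [Curve.ext_coe] using hV s s.2 t t.2
    _ ≤ |(t : ℝ) - s| * |V t - V s| := (le_abs_self _).trans (abs_mul _ _).le
    _ ≤ dist s t * (V 1 - V 0) := by
        rw [dist_comm, Subtype.dist_eq, Real.dist_eq]
        gcongr
    _ = 2 * (kineticAction γ).toReal * dist s t := by rw [heq, mul_comm]

theorem dist_le_sqrt_of_kineticAction_le {γ : Curve X} {c : ℝ≥0∞} (hc : c ≠ ⊤)
    (h : kineticAction γ ≤ c) (s t : unitInterval) :
    dist (γ s) (γ t) ≤ √(2 * c.toReal * dist s t) := by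
  refine Real.le_sqrt_of_sq_le
    ((dist_sq_le_kineticAction_mul (ne_top_of_le_ne_top hc h) s t).trans ?_)
  gcongr

theorem IsWeakTopology.kineticAction_le {ω : ℕ → Curve X} {ω₀ : Curve X} {c : ℝ≥0∞}
    (hσ : IsWeakTopology σ) (hω : PointwiseTendsto σ ω ω₀) (h : ∀ k, kineticAction (ω k) ≤ c) :
    kineticAction ω₀ ≤ c := by
  rcases eq_or_ne c ⊤ with rfl | hc
  · exact le_top
  choose V hV _ hVA using fun k =>
    exists_hasActionControl_of_kineticAction_ne_top (ne_top_of_le_ne_top hc (h k))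
  obtain ⟨W, hW, hWA⟩ := HasActionControl.exists_of_forall_sub_le (l := atTop) (γ := ω₀.ext)
    (A := 2 * c.toReal) zero_le_one hV
    (fun k => (hVA k).trans_le (by gcongr; exact h k))
    fun s hs t ht r hr => by
      lift s to unitInterval using hs
      lift t to unitInterval using ht
      simp only [Curve.ext_coe] at hr ⊢
      exact hσ.eventually_lt_dist (hω s) (hω t) hr
  calc kineticAction ω₀ ≤ ENNReal.ofReal ((W 1 - W 0) / 2) := hW.kineticAction_le
    _ ≤ ENNReal.ofReal c.toReal := ENNReal.ofReal_le_ofReal (by linarith)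
    _ = c := ENNReal.ofReal_toReal hc

theorem IsWeakTopology.kineticAction_le_liminf {ω : ℕ → Curve X} {ω₀ : Curve X}
    (hσ : IsWeakTopology σ) (hω : PointwiseTendsto σ ω ω₀) :
    kineticAction ω₀ ≤ liminf (fun k => kineticAction (ω k)) atTop := by
  refine le_of_forall_gt fun c hc => ?_
  obtain ⟨c', hc', hcc'⟩ := exists_between hc
  obtain ⟨φ, hφ, hle⟩ := extraction_of_frequently_atTop (frequently_lt_of_liminf_lt (h := hc'))
  exact (hσ.kineticAction_le (fun t => (hω t).comp hφ.tendsto_atTop) fun k => (hle k).le).trans_lt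
    hcc'

theorem IsWeakTopology.joins_of_pointwiseTendsto {ω : ℕ → Curve X} {ω₀ : Curve X}
    (hσ : IsWeakTopology σ) (hω : ∀ k, (ω k).Joins x y) (h : PointwiseTendsto σ ω ω₀) :
    ω₀.Joins x y := by
  have heq : ∀ (t : unitInterval) (p : X), (∀ k, ω k t = p) → ω₀ t = p := fun t p hp =>
    hσ.eq_of_tendsto (h t) (by simpa only [Curve.pos, hp] using @tendsto_const_nhds X σ ℕ p atTop)
  exact ⟨heq 0 x fun k => (hω k).1, heq 1 y fun k => (hω k).2⟩

theorem IsWeakTopology.exists_subseq_pointwiseTendsto {ω : ℕ → Curve X} {c : ℝ≥0∞}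
    (hσ : IsWeakTopology σ) (hω : ∀ k, (ω k).Joins x y) (hc : c ≠ ⊤)
    (h : ∃ᶠ k in atTop, kineticAction (ω k) ≤ c) :
    ∃ (ω₀ : Curve X) (φ : ℕ → ℕ), StrictMono φ ∧ PointwiseTendsto σ (fun k => ω (φ k)) ω₀ := by
  obtain ⟨φ, hφ, hle⟩ := extraction_of_frequently_atTop h
  have hholder := fun k => dist_le_sqrt_of_kineticAction_le hc (hle k)
  have hequi : UniformEquicontinuous fun k => ⇑(ω (φ k)) := by
    refine Metric.uniformEquicontinuous_of_continuity_modulus (fun r => √(2 * c.toReal * r)) ?_ _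
      fun s t k => hholder k s t
    have hcont : Continuous fun r => √(2 * c.toReal * r) := by fun_prop
    simpa using hcont.tendsto 0
  have hbdd : ∀ t, Bornology.IsBounded (range fun k => ω (φ k) t) := fun t => by
    refine (Metric.isBounded_closedBall (x := x) (r := √(2 * c.toReal * dist t 0))).subset
      (range_subset_iff.2 fun k => ?_)
    rw [Metric.mem_closedBall, ← (hω (φ k)).1]
    exact hholder k t 0
  obtain ⟨ψ, hψ, hlim⟩ := hσ.exists_strictMono_forall_tendsto hequi.equicontinuous hbdd
  choose Ω hΩ using hlim
  obtain ⟨ω₀, rfl⟩ := exists_curve_coe_eq (hσ.uniformContinuous_of_tendsto (hequi.comp ψ) hΩ)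
  exact ⟨ω₀, φ ∘ ψ, hφ.comp hψ, hΩ⟩

end CompactnessOfCurves

theorem IsEVIFunctional.isProperLSC {X : Type*} [MetricSpace X] [Nonempty X] {E : X → EReal}
    (hE : IsEVIFunctional E) : IsProperLSC E :=
  ⟨hE.ne_bot, hE.lsc, hE.dense_domain.nonempty⟩

theorem IsAdmissibleTopology.isWeakTopology {X : Type*} [MetricSpace X] {E : X → EReal}
    {σ : TopologicalSpace X} (hσ : IsAdmissibleTopology E σ) : IsWeakTopology σ :=
  ⟨hσ.bounded_seq_compact, hσ.dist_lsc⟩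

theorem corollary4p4_general {X : Type*} [MetricSpace X] {E : X → EReal} (hE : IsProperLSC E)
    {lam : ℝ} (hflow : ∀ p, ∃ u, IsEVIFlow E lam u p) {x y : X} {ε₀ : ℝ} (hε₀ : ε₀ ≠ 0)
    (hfinite : schrodingerCost E ε₀ x y ≠ ⊤) {σ : TopologicalSpace X} (hσ : IsWeakTopology σ)
    {ε : ℕ → ℝ} (hε : Tendsto ε atTop (𝓝 0)) :
    Tendsto (fun k => schrodingerCost E (ε k) x y) atTop (𝓝 (kineticCost x y)) ∧
    ∀ ω : ℕ → Curve X, (∀ k, IsSchrodingerMinimizer E (ε k) x y (ω k)) →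
      Tendsto (fun k => schrodingerAction E (ε k) (ω k)) atTop (𝓝 (kineticCost x y)) ∧
      ∃ (ω₀ : Curve X) (φ : ℕ → ℕ), StrictMono φ ∧
        PointwiseTendsto σ (fun k => ω (φ k)) ω₀ ∧
        ω₀.Joins x y ∧ kineticAction ω₀ = kineticCost x y := by
  have hcost := tendsto_schrodingerCost hE hflow hε₀ hfinite hε
  refine ⟨hcost, fun ω hω => ?_⟩
  have hjoins : ∀ k, (ω k).Joins x y := fun k => (hω k).1
  have haction : Tendsto (fun k => schrodingerAction E (ε k) (ω k)) atTop (𝓝 (kineticCost x y)) :=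
    hcost.congr fun k => (hω k).2.symm
  have hkinetic : Tendsto (fun k => kineticAction (ω k)) atTop (𝓝 (kineticCost x y)) :=
    tendsto_of_tendsto_of_tendsto_of_le_of_le tendsto_const_nhds haction
      (fun k => iInf₂_le (ω k) (hjoins k)) fun k => le_self_add
  have htop : kineticCost x y ≠ ⊤ :=
    ne_top_of_le_ne_top hfinite (kineticCost_le_schrodingerCost E ε₀ x y)
  have hbound : ∀ᶠ k in atTop, kineticAction (ω k) ≤ kineticCost x y + 1 :=
    hkinetic.eventually_le_const (ENNReal.lt_add_right htop one_ne_zero)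
  obtain ⟨ω₀, φ, hφ, hlim⟩ := hσ.exists_subseq_pointwiseTendsto hjoins
    (ENNReal.add_ne_top.2 ⟨htop, ENNReal.one_ne_top⟩) hbound.frequently
  have hjoins₀ : ω₀.Joins x y := hσ.joins_of_pointwiseTendsto (fun k => hjoins (φ k)) hlim
  have hle : kineticAction ω₀ ≤ kineticCost x y :=
    (hσ.kineticAction_le_liminf hlim).trans_eq (hkinetic.comp hφ.tendsto_atTop).liminf_eq
  exact ⟨haction, ω₀, φ, hφ, hlim, hjoins₀, hle.antisymm (iInf₂_le ω₀ hjoins₀)⟩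

theorem corollary4p4 {X : Type*} [MetricSpace X] [CompleteSpace X]
    [TopologicalSpace.SeparableSpace X] (E : X → EReal) (hE : IsEVIFunctional E)
    (x y : X) (hsolv : ∃ ε : ℝ, 0 < ε ∧ SchrodingerSolvable E ε x y)
    (σ : TopologicalSpace X) (hσ : IsAdmissibleTopology E σ)
    (ε : ℕ → ℝ) (hε_pos : ∀ k, 0 < ε k) (hε : Tendsto ε atTop (𝓝 0)) :
    Tendsto (fun k => schrodingerCost E (ε k) x y) atTop (𝓝 (kineticCost x y)) ∧
    ∀ ω : ℕ → Curve X, (∀ k, IsSchrodingerMinimizer E (ε k) x y (ω k)) →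
      Tendsto (fun k => kineticAction (ω k) + ENNReal.ofReal (ε k ^ 2) * fisherInformation E (ω k))
        atTop (𝓝 (kineticCost x y)) ∧
      ∃ (ω₀ : Curve X) (φ : ℕ → ℕ), StrictMono φ ∧
        PointwiseTendsto σ (fun k => ω (φ k)) ω₀ ∧
        ω₀.Joins x y ∧ kineticAction ω₀ = kineticCost x y := by
  obtain ⟨lam, hflow⟩ := hE.exists_flow
  obtain ⟨ε₀, hε₀, hfinite, -⟩ := hsolv
  have : Nonempty X := ⟨x⟩
  exact corollary4p4_general hE.isProperLSC hflow hε₀.ne' hfinite hσ.isWeakTopology hε
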